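/- Let $\Gamma$ be a discrete subgroup of $\mathrm{SL}_2(\mathbb C)$, acting on the upper half-space $\mathbb H^3=\mathbb C\times\,]0,\infty[$ through $\mathrm{PSL}_2(\mathbb C)=\mathrm{Isom}_+(\mathbb H^3)$, such that $M=\mathbb H^3/\Gamma$ is a geometrically finite, non-elementary hyperbolic $3$-orbifold. Suppose that $\infty$ is a parabolic fixed point of $\Gamma$, let $e$ be the corresponding cusp of $M$, and suppose that the stabilizer $\Gamma_\infty$ of $\infty$ acts on $\mathbb C$ as a group of translations. Write $\gamma=\pm\begin{pmatrix}a(\gamma)&b(\gamma)\\c(\gamma)&d(\gamma)\end{pmatrix}$. Cut locus. For $x\in\mathbb H^3$ let $N(x)$ be the number of geodesic rays from $x$ to points of the orbit $\Gamma\infty$ whose image in $M$ is globally minimizing. Let $\widetilde\Sigma=\{N\ge 2\}$ be the (lifted) cut locus of $e$ and $\widetilde\Sigma_0=\{N=2\}$ its regular part, whose connected components are called cells. Assume, as in the definition of a cute cut locus, that every cell has a summit, that is, contains a locally highest point for the Busemann function of $e$. Good approximants. Let $\xi$ be a totally irrational line starting from $e$: a geodesic line that comes from $e$, is recurrent in some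 compact subset of $M$, and meets the cut locus only in its regular part. Let $\widetilde\xi$ be a lift of $\xi$ starting from $\infty$, let $\widetilde x_0,\widetilde x_1,\dots$ be its successive intersection points with $\widetilde\Sigma$, and $\widetilde\sigma_n$ the cell that contains $\widetilde x_n$. Let $z_n\in\mathbb C$ be the endpoint of the lift starting from $\infty$ of the $n$-th good approximant of $\xi$, that is, the endpoint of the minimizing ray that starts from $\widetilde x_n$ on the side of $\widetilde\Sigma$ opposite to the one on which $\widetilde\xi$ arrives. Choose $\gamma_n\in\Gamma$ with $\gamma_n(\infty)=z_n$ for $n\ge0$, let $\gamma_{-1}=\mathrm{id}$, and let $q_i=c(\gamma_i)$ for $i\ge -1$, so that $q_{-1}=0$. Continued sequence. Let $a_0=0$. For $n\ge 0$, consider the path that goes along the minimizing ray from $z_n$ to the summit of $\widetilde\sigma_n$, then in $\widetilde\sigma_n$ to $\widetilde x_n$, then along $\widetilde\xi$ to $\widetilde x_{n+1}$, then in $\widetilde\sigma_{n+1}$ to its summit, then along the minimizing ray towards $z_n$. The minimizing rays towards $z_n$ retract it to a horosphere centred at $z_n$, which gives a homotopy class of paths in the quotient $L_e\cong\mathbb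 C/\Gamma_\infty$ of that horosphere (the identification being given by $\gamma_n^{-1}$ followed by the vertical projection). Let $a_{n+1}\in\mathbb C$ be the difference (end minus origin) of the endpoints of any lift to $\mathbb C$ of a path of this class. Then all these sequences exist, and for every $n\ge0$ the denominators below are non-zero and $$z_n=z_0+\sum_{k=1}^n\frac{(-1)^{k+1}}{\sum_{i=0}^k(-1)^i\,q_{i-1}^2\,a_i}.$$ -/

import Mathlib

open Set Filter Topology Matrix
open scoped MatrixGroups unitInterval

noncomputable section

namespace HypOrb

/-! ### Hyperbolic 3-space and its isometries -/

/-- The upper half-space `{(z, t) | z ∈ ℂ, t > 0}`.  Only its topology is taken from `ℂ × ℝ`;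
the hyperbolic distance is `hdist`. -/
abbrev H3 : Type := {x : ℂ × ℝ // 0 < x.2}

/-- The vertical projection to `ℂ`. -/
def vproj (x : H3) : ℂ := x.1.1

/-- The vertical coordinate. -/
def height (x : H3) : ℝ := x.1.2

/-- The hyperbolic distance of the metric `(|dz|² + dt²) / t²`. -/
def hdist (x y : H3) : ℝ :=
  2 * Real.arsinh (√(‖vproj x - vproj y‖ ^ 2 + (height x - height y) ^ 2) /
    (2 * √(height x * height y)))

/-- The quantity `|c z + d|² + |c|² t²`. -/
def autFactor (g : SL(2, ℂ)) (x : H3) : ℝ :=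
  ‖g 1 0 * vproj x + g 1 1‖ ^ 2 + ‖g 1 0‖ ^ 2 * height x ^ 2

theorem autFactor_pos (g : SL(2, ℂ)) (x : H3) : 0 < autFactor g x := by
  have ht : 0 < height x := x.2
  by_cases hc : g 1 0 = 0
  · have hd : g 1 1 ≠ 0 := by
      intro hd
      have h := g.det_coe
      rw [Matrix.det_fin_two, hc, hd] at h
      simp at h
    have : 0 < ‖g 1 1‖ := norm_pos_iff.mpr hd
    simp only [autFactor, hc, zero_mul, zero_add, norm_zero]
    positivity
  · have : 0 < ‖g 1 0‖ := norm_pos_iff.mpr hc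
    unfold autFactor
    positivity

/-- The Poincaré extension to the upper half-space of the Möbius transformation
`z ↦ (a z + b) / (c z + d)`. -/
def act (g : SL(2, ℂ)) (x : H3) : H3 :=
  ⟨(((g 0 0 * vproj x + g 0 1) * (starRingEnd ℂ) (g 1 0 * vproj x + g 1 1)
      + g 0 0 * (starRingEnd ℂ) (g 1 0) * (height x : ℂ) ^ 2) / (autFactor g x : ℂ),
    height x / autFactor g x), div_pos x.2 (autFactor_pos g x)⟩

theorem continuous_vproj : Continuous vproj := continuous_fst.comp continuous_subtype_val

theorem continuous_height : Continuous height := continuous_snd.comp continuous_subtype_val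

theorem continuous_autFactor (g : SL(2, ℂ)) : Continuous (autFactor g) := by
  have h1 := continuous_vproj
  have h2 := continuous_height
  unfold autFactor
  fun_prop

theorem continuous_act (g : SL(2, ℂ)) : Continuous (act g) := by
  have h1 := continuous_vproj
  have h2 := continuous_height
  have h3 := continuous_autFactor g
  refine Continuous.subtype_mk (Continuous.prodMk ?_ ?_) _
  · refine Continuous.div ?_ (by fun_prop) ?_
    · have : Continuous fun x : H3 => (starRingEnd ℂ) (g 1 0 * vproj x + g 1 1) :=
        Complex.continuous_conj.comp (by fun_prop)
      fun_prop
    · intro x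
      exact_mod_cast (autFactor_pos g x).ne'
  · exact Continuous.div h2 h3 fun x => (autFactor_pos g x).ne'

/-- The sphere at infinity is `ℂ ∪ {∞} = OnePoint ℂ`, with the usual action by Möbius
transformations. -/
def bact (g : SL(2, ℂ)) (p : OnePoint ℂ) : OnePoint ℂ := (g : GL (Fin 2) ℂ) • p

/-- The sphere at infinity as a subset of the compactification `(ℂ × ℝ) ∪ {∞}`, in which
`z ∈ ℂ` is the point `(z, 0)`. -/
def bdry (p : OnePoint ℂ) : OnePoint (ℂ × ℝ) := p.map fun z => (z, 0)

/-- A unit speed geodesic ray of hyperbolic space, defined on `[0, ∞)`. -/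
def IsGeodesicRay (ρ : ℝ → H3) : Prop :=
  ∀ s t : ℝ, 0 ≤ s → 0 ≤ t → hdist (ρ s) (ρ t) = |s - t|

/-- The curve `ρ` ends at the point at infinity `p`. -/
def EndsAt (ρ : ℝ → H3) (p : OnePoint ℂ) : Prop :=
  Tendsto (fun t => ((ρ t).1 : OnePoint (ℂ × ℝ))) atTop (𝓝 (bdry p))

/-! ### Geometrical finiteness

`Γ` is a subgroup of `SL(2, ℂ)` acting on hyperbolic space through its image in `PSL(2, ℂ)`; the
orbifold is `M = H3 / Γ`, and is always described by `Γ`-invariant objects on `H3`. -/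

/-- The curve `ρ` projects to a curve of `M` that comes back infinitely often, at
arbitrarily large times, to some compact subset of `M`. -/
def IsRecurrent (Γ : Subgroup SL(2, ℂ)) (ρ : ℝ → H3) : Prop :=
  ∃ K : Set H3, IsCompact K ∧ ∃ᶠ t in atTop, ∃ g ∈ Γ, act g (ρ t) ∈ K

/-- The limit set: the points at infinity in the closure of the orbit of the point `(0, 1)`
(for a discrete group, of any point). -/
def limitSet (Γ : Subgroup SL(2, ℂ)) : Set (OnePoint ℂ) :=
  {p | bdry p ∈ closure
    {w : OnePoint (ℂ × ℝ) | ∃ g ∈ Γ, w = ((act g ⟨(0, 1), one_pos⟩).1 : OnePoint (ℂ × ℝ))}}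

def IsConicalLimitPoint (Γ : Subgroup SL(2, ℂ)) (p : OnePoint ℂ) : Prop :=
  p ∈ limitSet Γ ∧ ∃ ρ, IsGeodesicRay ρ ∧ EndsAt ρ p ∧ IsRecurrent Γ ρ

/-- `p` is fixed by a parabolic element of `Γ`. -/
def IsParabolicPoint (Γ : Subgroup SL(2, ℂ)) (p : OnePoint ℂ) : Prop :=
  ∃ g ∈ Γ, (g : Matrix (Fin 2) (Fin 2) ℂ).IsParabolic ∧ bact g p = p

/-- Bounded parabolic points: the quotient of `limitSet Γ \ {p}` by the stabilizer of `p` is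
compact, that is, the translates of some compact subset of it cover it. -/
def IsBoundedParabolicPoint (Γ : Subgroup SL(2, ℂ)) (p : OnePoint ℂ) : Prop :=
  p ∈ limitSet Γ ∧ IsParabolicPoint Γ p ∧
    ∃ K : Set (OnePoint ℂ), IsCompact K ∧ K ⊆ limitSet Γ \ {p} ∧
      ∀ w ∈ limitSet Γ \ {p}, ∃ g ∈ Γ, bact g p = p ∧ bact g w ∈ K

def IsGeometricallyFinite (Γ : Subgroup SL(2, ℂ)) : Prop :=
  ∀ p ∈ limitSet Γ, IsConicalLimitPoint Γ p ∨ IsBoundedParabolicPoint Γ p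

def IsNonElementary (Γ : Subgroup SL(2, ℂ)) : Prop := 3 ≤ (limitSet Γ).encard

/-- The stabilizer of `∞` in `Γ` acts on `ℂ` as a group of translations. -/
def StabilizerIsTranslations (Γ : Subgroup SL(2, ℂ)) : Prop :=
  ∀ g ∈ Γ, bact g OnePoint.infty = OnePoint.infty →
    ∃ b : ℂ, ∀ z : ℂ, bact g z = ((z + b : ℂ) : OnePoint ℂ)

/-! ### The cut locus of the cusp `e` of `M` defined by the orbit of `∞` -/

/-- The distance in `M` between the images of two points. -/
def orbDist (Γ : Subgroup SL(2, ℂ)) (x y : H3) : ℝ := ⨅ g : Γ, hdist x (act g y)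

/-- `ρ` is a geodesic ray, starting at `x` and ending at the point `p` of the orbit of `∞`, whose
image in `M` (a ray converging to the cusp `e`) is globally minimizing. -/
structure IsMinimizingRay (Γ : Subgroup SL(2, ℂ)) (x : H3) (p : OnePoint ℂ) (ρ : ℝ → H3) :
    Prop where
  start : ρ 0 = x
  geodesic : IsGeodesicRay ρ
  endsAt : EndsAt ρ p
  orbit : ∃ g ∈ Γ, p = bact g OnePoint.infty
  minimizing : ∀ s t : ℝ, 0 ≤ s → 0 ≤ t → orbDist Γ (ρ s) (ρ t) = |s - t|

/-- The endpoints of the minimizing rays from `x` to the cusp.  A geodesic ray is determined by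
its origin and its endpoint, so that the cardinality of this set is the number `N(x)` of
minimizing rays of `M` that start from the image of `x` and converge to the cusp (counted with
multiplicity at singular points). -/
def nearestEnds (Γ : Subgroup SL(2, ℂ)) (x : H3) : Set (OnePoint ℂ) :=
  {p | ∃ ρ, IsMinimizingRay Γ x p ρ}

/-- The preimage in `H3` of the cut locus `Σ = {N ≥ 2}` of the cusp. -/
def cutLocus (Γ : Subgroup SL(2, ℂ)) : Set H3 := {x | 2 ≤ (nearestEnds Γ x).encard}

/-- The preimage in `H3` of the regular part `Σ₀ = {N = 2}` of the cut locus. -/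
def regCutLocus (Γ : Subgroup SL(2, ℂ)) : Set H3 := {x | (nearestEnds Γ x).encard = 2}

/-- The cell (connected component of the preimage of `Σ₀`) that contains `x`. -/
def cell (Γ : Subgroup SL(2, ℂ)) (x : H3) : Set H3 := connectedComponentIn (regCutLocus Γ) x

/-- The Busemann function of the cusp (up to an additive constant), as a function on `H3`:
`t - d_M(x, r(t))` for large `t`, where `r` is the image in `M` of the vertical ray
`t ↦ (0, exp t)`. -/
def busemann (Γ : Subgroup SL(2, ℂ)) (x : H3) : ℝ :=
  limUnder atTop fun t : ℝ => t - orbDist Γ x ⟨(0, Real.exp t), Real.exp_pos t⟩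

/-- `y` is a summit of the cell `C`: a locally highest point that belongs to `C`. -/
def IsSummit (Γ : Subgroup SL(2, ℂ)) (C : Set H3) (y : H3) : Prop :=
  y ∈ C ∧ IsLocalMaxOn (busemann Γ) C y

/-- Every cell has a summit, which is the part of the definition of a cute cut locus that is
needed for the continued sequence to be defined. -/
def CellsHaveSummits (Γ : Subgroup SL(2, ℂ)) : Prop :=
  ∀ x ∈ regCutLocus Γ, ∃ y, IsSummit Γ (cell Γ x) y

/-! ### Totally irrational lines and good approximants -/

/-- The geodesic line from `∞` to `ξ ∈ ℂ`; these are the lifts starting from `∞` of the geodesic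
lines of `M` starting from the cusp. -/
def line (ξ : ℂ) (t : ℝ) : H3 := ⟨(ξ, Real.exp (-t)), Real.exp_pos _⟩

/-- The line is recurrent and meets the cut locus only in its regular part.  (As the
components of `Σ₀` are totally geodesic, the line is then transverse to them.) -/
def IsTotallyIrrational (Γ : Subgroup SL(2, ℂ)) (ξ : ℂ) : Prop :=
  IsRecurrent Γ (line ξ) ∧ ∀ t, line ξ t ∈ cutLocus Γ → line ξ t ∈ regCutLocus Γ

/-- `p` is the endpoint of the minimizing ray to the cusp that starts from the point `line ξ s` of
the cut locus on the other side of the cut locus than the one on which the line arrives. -/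
def IsOppositeEnd (Γ : Subgroup SL(2, ℂ)) (ξ : ℂ) (s : ℝ) (p : OnePoint ℂ) : Prop :=
  ∃ ρ, IsMinimizingRay Γ (line ξ s) p ρ ∧
    ∀ᶠ u in 𝓝[>] (0 : ℝ), ¬ JoinedIn (cutLocus Γ)ᶜ (line ξ (s - u)) (ρ u)

/-- The successive intersections `x_n = line ξ (t n)` with the cut locus, and the endpoints `z n`
of the lifts starting from `∞` of the good approximants `r_n`: the path `c_n` that follows
the line up to `x_n`, and then the minimizing ray on the opposite side, lifts to a path from
`∞` to `z n`, and `r_n` is the image of the geodesic line from `∞` to `z n`, the only one that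
is properly homotopic to `c_n`.  The element `γ n` of `Γ` maps `∞` to `z n`, and
`γ (-1) = 1`. -/
structure IsGoodApproximation (Γ : Subgroup SL(2, ℂ)) (ξ : ℂ) (t : ℕ → ℝ) (z : ℕ → ℂ)
    (γ : ℤ → SL(2, ℂ)) : Prop where
  strictMono : StrictMono t
  range_eq : range t = {s | line ξ s ∈ cutLocus Γ}
  oppositeEnd : ∀ n : ℕ, IsOppositeEnd Γ ξ (t n) (z n)
  mem : ∀ n : ℕ, γ n ∈ Γ
  apply_infty : ∀ n : ℕ, bact (γ n) OnePoint.infty = (z n : OnePoint ℂ)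
  neg_one : γ (-1) = 1

/-! ### The continued sequence -/

theorem bact_mul (g h : SL(2, ℂ)) (p : OnePoint ℂ) : bact (g * h) p = bact g (bact h p) := by
  simp [bact, mul_smul]

theorem bact_one (p : OnePoint ℂ) : bact 1 p = p := by
  simp [bact]

/-- The translations of `ℂ` that belong to `Γ`. -/
def translations (Γ : Subgroup SL(2, ℂ)) : AddSubgroup ℂ where
  carrier := {b | ∃ g ∈ Γ, ∀ z : ℂ, bact g z = ((z + b : ℂ) : OnePoint ℂ)}
  zero_mem' := ⟨1, Γ.one_mem, fun z => by rw [bact_one, add_zero]⟩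
  add_mem' := by
    rintro b b' ⟨g, hg, h⟩ ⟨g', hg', h'⟩
    refine ⟨g * g', Γ.mul_mem hg hg', fun z => ?_⟩
    rw [bact_mul, h', h, add_assoc, add_comm b' b]
  neg_mem' := by
    rintro b ⟨g, hg, h⟩
    refine ⟨g⁻¹, Γ.inv_mem hg, fun z => ?_⟩
    have := h (z + -b)
    rw [neg_add_cancel_right] at this
    rw [← this, ← bact_mul, inv_mul_cancel, bact_one]

/-- The boundary `L_e` of a standard neighbourhood of the cusp, a quotient of a horizontal
horosphere, which is identified with a quotient of `ℂ` by vertical projection. -/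
abbrev CuspSection (Γ : Subgroup SL(2, ℂ)) : Type := ℂ ⧸ translations Γ

/-- On the closed basin of `g ∞`, that is, on the set of points from which starts a minimizing ray
to `g ∞`, this is the lift of the canonical retraction of `M` minus the cut locus to `L_e`,
extended by continuity to the closed basin: it follows the ray to `g ∞`, which `g⁻¹` makes
vertical. -/
def retraction (Γ : Subgroup SL(2, ℂ)) (g : SL(2, ℂ)) : C(H3, CuspSection Γ) :=
  ⟨fun x => QuotientAddGroup.mk (vproj (act g⁻¹ x)),
    continuous_quot_mk.comp (continuous_vproj.comp (continuous_act g⁻¹))⟩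

/-- A lift of the path that defines a term of the continued sequence, between the intersections
`line ξ s` and `line ξ s'` with the cut locus: it runs along the minimizing ray from `p` to the
summit of the first cell, in that cell to `line ξ s`, along the line to `line ξ s'`, in the
second cell to its summit, and along the minimizing ray towards `p`.  The whole path stays in
the closed basin of `p`, so it need not be pushed off the cut locus; its origin and its end are
arbitrary points of the two rays, all of which have the same image under the retraction. -/
structure ContinuedPath (Γ : Subgroup SL(2, ℂ)) (ξ : ℂ) (s s' : ℝ) (p : OnePoint ℂ) where
  (l y y' l' : H3)
  summit : IsSummit Γ (cell Γ (line ξ s)) y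
  summit' : IsSummit Γ (cell Γ (line ξ s')) y'
  rayIn : Path l y
  rayIn_mem : ∃ ρ, IsMinimizingRay Γ y p ρ ∧ ∀ u, rayIn u ∈ ρ '' Ici 0
  cellIn : Path y (line ξ s)
  cellIn_mem : ∀ u, cellIn u ∈ cell Γ (line ξ s)
  along : Path (line ξ s) (line ξ s')
  along_mem : ∀ u, along u ∈ line ξ '' Icc s s'
  cellOut : Path (line ξ s') y'
  cellOut_mem : ∀ u, cellOut u ∈ cell Γ (line ξ s')
  rayOut : Path y' l'
  rayOut_mem : ∃ ρ, IsMinimizingRay Γ y' p ρ ∧ ∀ u, rayOut u ∈ ρ '' Ici 0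

/-- The whole path. -/
def ContinuedPath.total {Γ : Subgroup SL(2, ℂ)} {ξ : ℂ} {s s' : ℝ} {p : OnePoint ℂ}
    (c : ContinuedPath Γ ξ s s' p) : Path c.l c.l' :=
  (((c.rayIn.trans c.cellIn).trans c.along).trans c.cellOut).trans c.rayOut

/-- The identification of homotopy classes of paths of `L_e` with complex numbers: `w` is the
difference of the endpoints of a lift to `ℂ` of a path in the class `A`. -/
def HasDisplacement (Γ : Subgroup SL(2, ℂ)) {p q : CuspSection Γ}
    (A : Path.Homotopic.Quotient p q) (w : ℂ) : Prop :=
  ∃ (x y : ℂ) (c : Path x y) (hx : p = QuotientAddGroup.mk x) (hy : q = QuotientAddGroup.mk y),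
    A = Path.Homotopic.Quotient.mk
      ((c.map (f := (QuotientAddGroup.mk : ℂ → CuspSection Γ)) continuous_quot_mk).cast hx hy) ∧
    w = y - x

/-- `a` is the continued sequence of the line, as a sequence of complex numbers: `a 0` corresponds
to a constant path, and `a (n + 1)` to the homotopy class of the image in `L_e` of the path
of `ContinuedPath` between the `n`-th and the next intersection with the cut locus. -/
def IsContinuedSequence (Γ : Subgroup SL(2, ℂ)) (ξ : ℂ) (t : ℕ → ℝ) (z : ℕ → ℂ)
    (γ : ℤ → SL(2, ℂ)) (a : ℕ → ℂ) : Prop :=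
  a 0 = 0 ∧ ∀ n : ℕ, ∃ c : ContinuedPath Γ ξ (t n) (t (n + 1)) (z n),
    HasDisplacement Γ
      (Path.Homotopic.Quotient.mk (c.total.map (retraction Γ (γ n)).continuous)) (a (n + 1))

end HypOrb

end

/-!
The proof rests on one function: for `g ∈ Γ`, the automorphy factor `autFactor g x = |c z + d|² +
|c|² t²`, by which `g` divides the height of `x`.  A ray from `x` to `g⁻¹ ∞` is globally minimizing
if and only if `g` minimizes this factor at `x` (`mem_nearestEnds_iff`), so that the cut locus is
the locus where the minimum is reached for several points of the orbit of `∞`.  This locus is well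
behaved because the bottom rows of the elements of `Γ` are locally finite (`finite_bounded_rows`):
for a translation `u ∈ Γ`, the entries of `g⁻¹ * u * g` determine the row of `g` up to finitely many
choices, and `Γ` is discrete.  Hence the set of nearest ends is nonempty and upper semicontinuous,
and constant on connected sets where its cardinality is constant.

All automorphy factors are affine functions of one and the same parameter along a geodesic segment
(`autFactor_segment`), and so the cell of `x` is the set of points with the same nearest ends as `x`
(`cell_eq`), and is convex.  The Busemann function of the cusp is the logarithm of the largest
height in the orbit (`busemann_eq`); seen from one of its two ends, a cell is an open piece of a
hemisphere centred at the other end, and its summit is the top of the hemisphere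
(`IsSummit.bact_eq_vproj`).

Along the vertical line to `ξ`, an automorphy factor is an affine function of `exp (-t) ^ 2` with
slope `|c|²`.  The line therefore crosses the cut locus transversally, from the basin of an end to
that of another one with a larger slope, at a discrete sequence of parameters, which is infinite by
recurrence; the good approximants are the ends of the successive basins
(`IsGoodApproximation.isCrossing`).  The path that defines `a (n + 1)` joins two summits, and `γ n`
maps `∞` to the common end `z n` of their cells; by uniqueness of lifts to the covering
`ℂ → ℂ / translations Γ`, this gives `a (n + 1) = (γ n)⁻¹ (z (n + 1)) - (γ n)⁻¹ (z (n - 1))`, with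
`z (-1) = ∞` (`ContinuedPath.displacement`).  As `γ⁻¹ w = -d / c + 1 / (c² (γ ∞ - w))`, it follows
that `q n ^ 2 * a (n + 1) = 1 / (z n - z (n + 1)) - 1 / (z n - z (n - 1))`, where the last term is
zero for `n = 0`, and the alternating sums of these terms telescope (`alternating_sum_eq`).
-/

namespace HypOrb

/-! ### The Hermitian model and the isometric action -/

theorem height_pos (x : H3) : 0 < height x := x.2

theorem H3.ext {x y : H3} (h₁ : vproj x = vproj y) (h₂ : height x = height y) : x = y :=
  Subtype.ext (Prod.ext h₁ h₂)

theorem height_act (g : SL(2, ℂ)) (x : H3) : height (act g x) = height x / autFactor g x := rfl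

theorem det_eq (g : SL(2, ℂ)) : g 0 0 * g 1 1 - g 0 1 * g 1 0 = 1 := by
  have h := g.det_coe
  rwa [Matrix.det_fin_two] at h

/-- The positive definite Hermitian matrix of determinant `1` that represents a point of
hyperbolic space. -/
noncomputable def herm (x : H3) : Matrix (Fin 2) (Fin 2) ℂ :=
  !![(vproj x * (starRingEnd ℂ) (vproj x) + (height x : ℂ) ^ 2) / height x, vproj x / height x;
    (starRingEnd ℂ) (vproj x) / height x, 1 / height x]

theorem herm_injective : Function.Injective herm := by
  intro x y h
  have hx : (height x : ℂ) ≠ 0 := by exact_mod_cast (height_pos x).ne'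
  have hy : (height y : ℂ) ≠ 0 := by exact_mod_cast (height_pos y).ne'
  have h1 := congrFun (congrFun h 1) 1
  have h2 := congrFun (congrFun h 0) 1
  simp only [herm, of_apply, cons_val', cons_val_zero, cons_val_one, cons_val_fin_one] at h1 h2
  have h3 : height x = height y := by
    field_simp at h1
    exact_mod_cast h1.symm
  refine H3.ext ?_ h3
  rw [h3] at h2
  field_simp at h2
  exact h2

theorem autFactor_ofReal (g : SL(2, ℂ)) (x : H3) :
    (autFactor g x : ℂ) = (g 1 0 * vproj x + g 1 1) * (starRingEnd ℂ) (g 1 0 * vproj x + g 1 1)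
      + g 1 0 * (starRingEnd ℂ) (g 1 0) * (height x : ℂ) ^ 2 := by
  simp only [autFactor, Complex.mul_conj, Complex.normSq_eq_norm_sq]
  push_cast
  ring

/-- The Poincaré extension of `g` is the action `X ↦ g X gᴴ` on Hermitian matrices; this makes it
plain that it is an action, and an isometric one. -/
theorem herm_act (g : SL(2, ℂ)) (x : H3) :
    herm (act g x) = (g : Matrix (Fin 2) (Fin 2) ℂ) * herm x *
      (g : Matrix (Fin 2) (Fin 2) ℂ)ᴴ := by
  have hh : (height x : ℂ) ≠ 0 := by exact_mod_cast (height_pos x).ne'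
  have hF : (autFactor g x : ℂ) ≠ 0 := by exact_mod_cast (autFactor_pos g x).ne'
  have hF' := autFactor_ofReal g x
  have hdet := det_eq g
  have hdet' := congrArg (starRingEnd ℂ) hdet
  have hv : vproj (act g x) = ((g 0 0 * vproj x + g 0 1) *
      (starRingEnd ℂ) (g 1 0 * vproj x + g 1 1)
      + g 0 0 * (starRingEnd ℂ) (g 1 0) * (height x : ℂ) ^ 2) / (autFactor g x : ℂ) := rfl
  have hk : (height (act g x) : ℂ) = height x / autFactor g x := by
    rw [height_act]; push_cast; rfl
  have hc : (starRingEnd ℂ) (autFactor g x : ℂ) = autFactor g x := Complex.conj_ofReal _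
  have hc' : (starRingEnd ℂ) (height x : ℂ) = height x := Complex.conj_ofReal _
  ext i j
  fin_cases i <;> fin_cases j <;>
    simp only [herm, hv, hk, Matrix.mul_apply, Fin.sum_univ_two, conjTranspose_apply, of_apply,
      cons_val', cons_val_zero, cons_val_one, cons_val_fin_one, Fin.zero_eta, Fin.mk_one,
      map_add, map_mul, map_div₀, map_pow, map_sub, map_one, Complex.conj_conj, hc, hc',
      Complex.star_def, Fin.isValue] at hF' hdet' ⊢
  · field_simp
    rw [hF']
    -- what remains is `(height x) ^ 2` times `1 - |det g| ^ 2 = 0`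
    linear_combination ((height x : ℂ) ^ 2 * ((starRingEnd ℂ) (g 0 0) * (starRingEnd ℂ) (g 1 1) -
      (starRingEnd ℂ) (g 0 1) * (starRingEnd ℂ) (g 1 0))) * (-hdet) - (height x : ℂ) ^ 2 * hdet'
  · field_simp
    ring
  · field_simp
    ring
  · field_simp
    rw [hF']
    ring

theorem act_mul (g h : SL(2, ℂ)) (x : H3) : act (g * h) x = act g (act h x) := by
  apply herm_injective
  simp only [herm_act, Matrix.SpecialLinearGroup.coe_mul, conjTranspose_mul, Matrix.mul_assoc]

theorem act_one (x : H3) : act 1 x = x := by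
  apply herm_injective
  simp [herm_act]

theorem act_inv_act (g : SL(2, ℂ)) (x : H3) : act g⁻¹ (act g x) = x := by
  rw [← act_mul, inv_mul_cancel, act_one]

theorem act_act_inv (g : SL(2, ℂ)) (x : H3) : act g (act g⁻¹ x) = x := by
  rw [← act_mul, mul_inv_cancel, act_one]

theorem autFactor_mul (g h : SL(2, ℂ)) (x : H3) :
    autFactor (g * h) x = autFactor g (act h x) * autFactor h x := by
  have h1 := height_act (g * h) x
  rw [act_mul, height_act, height_act] at h1
  have := (height_pos x).ne'
  have := (autFactor_pos g (act h x)).ne'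
  have := (autFactor_pos h x).ne'
  have := (autFactor_pos (g * h) x).ne'
  field_simp at h1
  linarith

theorem norm_sq_act (g : SL(2, ℂ)) (x : H3) :
    ‖vproj (act g x)‖ ^ 2 + height (act g x) ^ 2 =
      (‖g 0 0 * vproj x + g 0 1‖ ^ 2 + ‖g 0 0‖ ^ 2 * height x ^ 2) / autFactor g x := by
  have hh := (height_pos x).ne'
  have hF := (autFactor_pos g x).ne'
  have hh' : (height x : ℂ) ≠ 0 := by exact_mod_cast hh
  have hF' : (autFactor g x : ℂ) ≠ 0 := by exact_mod_cast hF
  have h := congrFun (congrFun (herm_act g x) 0) 0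
  simp only [herm, height_act, Matrix.mul_apply, Fin.sum_univ_two, conjTranspose_apply, of_apply,
    cons_val', cons_val_zero, cons_val_one, cons_val_fin_one, Complex.star_def] at h
  have h1 := Complex.mul_conj' (vproj (act g x))
  have h2 := Complex.mul_conj' (g 0 0 * vproj x + g 0 1)
  have h3 := Complex.mul_conj' (g 0 0)
  rw [h1] at h
  apply Complex.ofReal_injective
  rw [height_act]
  push_cast at h ⊢
  rw [← h2, ← h3]
  simp only [map_add, map_mul]
  field_simp at h ⊢
  linear_combination h

theorem hdist_nonneg (x y : H3) : 0 ≤ hdist x y := by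
  have : 0 ≤ Real.arsinh (√(‖vproj x - vproj y‖ ^ 2 + (height x - height y) ^ 2) /
    (2 * √(height x * height y))) := Real.arsinh_nonneg_iff.mpr (by positivity)
  unfold hdist
  linarith

theorem cosh_hdist (x y : H3) : Real.cosh (hdist x y) =
    (‖vproj x - vproj y‖ ^ 2 + height x ^ 2 + height y ^ 2) / (2 * height x * height y) := by
  have hx := height_pos x
  have hy := height_pos y
  rw [hdist, Real.cosh_two_mul, Real.cosh_sq, Real.sinh_arsinh, div_pow, mul_pow,
    Real.sq_sqrt (by positivity), Real.sq_sqrt (by positivity)]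
  field_simp
  ring

theorem eq_of_cosh_eq {a b : ℝ} (ha : 0 ≤ a) (hb : 0 ≤ b) (h : Real.cosh a = Real.cosh b) :
    a = b :=
  Real.cosh_strictMonoOn.injOn ha hb h

/-- The hyperbolic cosine of the distance is a trace, hence invariant under the action. -/
theorem trace_herm_mul_adjugate (x y : H3) : (herm x * (herm y).adjugate).trace =
    ((2 * Real.cosh (hdist x y) : ℝ) : ℂ) := by
  have hx : (height x : ℂ) ≠ 0 := by exact_mod_cast (height_pos x).ne'
  have hy : (height y : ℂ) ≠ 0 := by exact_mod_cast (height_pos y).ne'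
  rw [cosh_hdist, adjugate_fin_two, trace_fin_two]
  have := Complex.mul_conj' (vproj x - vproj y)
  push_cast
  rw [← this]
  simp only [herm, Matrix.mul_apply, Fin.sum_univ_two, of_apply, cons_val', cons_val_zero,
    cons_val_one, cons_val_fin_one, map_sub]
  field_simp
  ring

theorem hdist_act (g : SL(2, ℂ)) (x y : H3) : hdist (act g x) (act g y) = hdist x y := by
  apply eq_of_cosh_eq (hdist_nonneg _ _) (hdist_nonneg _ _)
  have h := trace_herm_mul_adjugate (act g x) (act g y)
  have hg : (g : Matrix (Fin 2) (Fin 2) ℂ).adjugate * (g : Matrix (Fin 2) (Fin 2) ℂ) = 1 := by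
    rw [adjugate_mul, g.det_coe, one_smul]
  have hg' : (g : Matrix (Fin 2) (Fin 2) ℂ)ᴴ * (g : Matrix (Fin 2) (Fin 2) ℂ)ᴴ.adjugate = 1 := by
    rw [mul_adjugate, det_conjTranspose, g.det_coe, star_one, one_smul]
  have key : (herm (act g x) * (herm (act g y)).adjugate) =
      (g : Matrix (Fin 2) (Fin 2) ℂ) * (herm x * (herm y).adjugate) *
        (g : Matrix (Fin 2) (Fin 2) ℂ).adjugate := by
    rw [herm_act, herm_act, adjugate_mul_distrib, adjugate_mul_distrib]
    calc _ = (g : Matrix (Fin 2) (Fin 2) ℂ) * herm x * ((g : Matrix (Fin 2) (Fin 2) ℂ)ᴴ *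
          (g : Matrix (Fin 2) (Fin 2) ℂ)ᴴ.adjugate) * (herm y).adjugate *
          (g : Matrix (Fin 2) (Fin 2) ℂ).adjugate := by simp only [Matrix.mul_assoc]
      _ = _ := by rw [hg', Matrix.mul_one]; simp only [Matrix.mul_assoc]
  rw [key, trace_mul_comm, ← Matrix.mul_assoc, hg, Matrix.one_mul, trace_herm_mul_adjugate] at h
  have h' := Complex.ofReal_injective h
  linarith

theorem abs_log_height_le_hdist (x y : H3) :
    |Real.log (height x) - Real.log (height y)| ≤ hdist x y := by
  have hx := height_pos x
  have hy := height_pos y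
  rw [← abs_of_nonneg (hdist_nonneg x y), ← Real.cosh_le_cosh, cosh_hdist, Real.cosh_eq,
    neg_sub, Real.exp_sub, Real.exp_sub, Real.exp_log hx, Real.exp_log hy]
  have : (height x / height y + height y / height x) / 2 =
      (height x ^ 2 + height y ^ 2) / (2 * height x * height y) := by
    field_simp
  rw [this]
  gcongr
  nlinarith [sq_nonneg ‖vproj x - vproj y‖]

theorem continuous_hdist_left (y : H3) : Continuous fun x => hdist x y := by
  unfold hdist
  have h1 := continuous_vproj
  have h2 := continuous_height
  refine continuous_const.mul (Real.continuous_arsinh.comp (Continuous.div ?_ ?_ ?_))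
  · fun_prop
  · fun_prop
  · intro x
    have := height_pos x
    have := height_pos y
    positivity

/-! ### Möbius transformations of the sphere at infinity -/

theorem bact_infty (g : SL(2, ℂ)) :
    bact g OnePoint.infty = if g 1 0 = 0 then OnePoint.infty
      else ((g 0 0 / g 1 0 : ℂ) : OnePoint ℂ) := by
  simp only [bact, OnePoint.smul_infty_eq_ite]
  split_ifs with h₁ h₂ h₂ <;> first | rfl | exact absurd h₁ h₂ | exact absurd h₂ h₁

theorem bact_coe (g : SL(2, ℂ)) (z : ℂ) :
    bact g z = if g 1 0 * z + g 1 1 = 0 then OnePoint.infty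
      else (((g 0 0 * z + g 0 1) / (g 1 0 * z + g 1 1) : ℂ) : OnePoint ℂ) := by
  simp only [bact, OnePoint.smul_some_eq_ite]
  split_ifs with h₁ h₂ h₂ <;> first | rfl | exact absurd h₁ h₂ | exact absurd h₂ h₁

theorem bact_inv_bact (g : SL(2, ℂ)) (p : OnePoint ℂ) : bact g⁻¹ (bact g p) = p := by
  rw [← bact_mul, inv_mul_cancel, bact_one]

theorem bact_bact_inv (g : SL(2, ℂ)) (p : OnePoint ℂ) : bact g (bact g⁻¹ p) = p := by
  rw [← bact_mul, mul_inv_cancel, bact_one]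

theorem inv_entries (g : SL(2, ℂ)) : g⁻¹ 0 0 = g 1 1 ∧ g⁻¹ 0 1 = - g 0 1 ∧
    g⁻¹ 1 0 = - g 1 0 ∧ g⁻¹ 1 1 = g 0 0 := by
  have : (g⁻¹ : SL(2, ℂ)).1 = !![g 1 1, -g 0 1; -g 1 0, g 0 0] := by
    rw [← adjugate_fin_two]; rfl
  refine ⟨?_, ?_, ?_, ?_⟩
  · exact congrFun (congrFun this 0) 0
  · exact congrFun (congrFun this 0) 1
  · exact congrFun (congrFun this 1) 0
  · exact congrFun (congrFun this 1) 1

/-! ### Geodesic rays -/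

/-- The unit speed vertical ray that starts from `x` and goes up to `∞`. -/
noncomputable def vray (x : H3) (t : ℝ) : H3 :=
  ⟨(vproj x, height x * Real.exp t), mul_pos (height_pos x) (Real.exp_pos t)⟩

@[simp] theorem vproj_vray (x : H3) (t : ℝ) : vproj (vray x t) = vproj x := rfl

@[simp] theorem height_vray (x : H3) (t : ℝ) : height (vray x t) = height x * Real.exp t := rfl

@[simp] theorem vray_zero (x : H3) : vray x 0 = x := H3.ext rfl (by simp)

/-- The unit speed ray that starts from `x` and ends at `g⁻¹ ∞`. -/
noncomputable def rayTo (g : SL(2, ℂ)) (x : H3) (t : ℝ) : H3 := act g⁻¹ (vray (act g x) t)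

@[simp] theorem act_rayTo (g : SL(2, ℂ)) (x : H3) (t : ℝ) :
    act g (rayTo g x t) = vray (act g x) t := act_act_inv g _

@[simp] theorem rayTo_zero (g : SL(2, ℂ)) (x : H3) : rayTo g x 0 = x := by
  rw [rayTo, vray_zero, act_inv_act]

theorem hdist_vray (x : H3) (s t : ℝ) : hdist (vray x s) (vray x t) = |s - t| := by
  apply eq_of_cosh_eq (hdist_nonneg _ _) (abs_nonneg _)
  have hx := height_pos x
  rw [cosh_hdist, Real.cosh_abs, Real.cosh_eq, neg_sub, Real.exp_sub, Real.exp_sub]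
  simp only [vproj_vray, height_vray, sub_self, norm_zero]
  have := Real.exp_pos s
  have := Real.exp_pos t
  field_simp
  ring

theorem isGeodesicRay_rayTo (g : SL(2, ℂ)) (x : H3) : IsGeodesicRay (rayTo g x) := by
  intro s t _ _
  rw [rayTo, rayTo, hdist_act, hdist_vray]

theorem endsAt_infty_iff (ρ : ℝ → H3) : EndsAt ρ OnePoint.infty ↔
    Tendsto (fun t => ‖vproj (ρ t)‖ ^ 2 + height (ρ t) ^ 2) atTop atTop := by
  have h1 : EndsAt ρ OnePoint.infty ↔ Tendsto (fun t => ‖(ρ t).1‖) atTop atTop := by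
    have : bdry OnePoint.infty = OnePoint.infty := rfl
    rw [EndsAt, this,
      show (fun t => ((ρ t).1 : OnePoint (ℂ × ℝ))) = (↑) ∘ fun t => (ρ t).1 from rfl,
      ← tendsto_comap_iff, OnePoint.comap_coe_nhds_infty, coclosedCompact_eq_cocompact,
      ← Metric.cobounded_eq_cocompact,
      ← comap_norm_atTop, tendsto_comap_iff]
    rfl
  have hz : ∀ t, ‖(ρ t).1‖ = max ‖vproj (ρ t)‖ (height (ρ t)) := by
    intro t
    rw [Prod.norm_def]
    congr 1
    exact Real.norm_of_nonneg (height_pos _).le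
  rw [h1]
  constructor
  · intro h
    refine tendsto_atTop_mono' _ ?_ h
    filter_upwards [h.eventually_ge_atTop 1] with t ht
    have h2 := norm_nonneg (vproj (ρ t))
    have h3 := height_pos (ρ t)
    rcases max_choice ‖vproj (ρ t)‖ (height (ρ t)) with h' | h' <;>
      rw [hz, h'] at ht ⊢ <;> nlinarith
  · intro h
    rw [tendsto_atTop] at h ⊢
    intro b
    filter_upwards [h (2 * b ^ 2)] with t ht
    by_contra! hlt
    have h2 := norm_nonneg (vproj (ρ t))
    have h3 := height_pos (ρ t)
    rw [hz, max_lt_iff] at hlt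
    nlinarith

theorem endsAt_coe_iff (ρ : ℝ → H3) (w : ℂ) : EndsAt ρ w ↔
    Tendsto (fun t => vproj (ρ t)) atTop (𝓝 w) ∧ Tendsto (fun t => height (ρ t)) atTop (𝓝 0) := by
  have : bdry (w : OnePoint ℂ) = ((w, (0 : ℝ)) : ℂ × ℝ) := rfl
  rw [EndsAt, this]
  have h := OnePoint.isOpenEmbedding_coe (X := ℂ × ℝ)
  rw [show (fun t => ((ρ t).1 : OnePoint (ℂ × ℝ))) = (↑) ∘ fun t => (ρ t).1 from rfl,
    ← h.tendsto_nhds_iff, nhds_prod_eq, tendsto_prod_iff']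
  rfl

theorem vproj_act (g : SL(2, ℂ)) (x : H3) (hc : g 1 0 ≠ 0) : vproj (act g x) =
    g 0 0 / g 1 0 - (starRingEnd ℂ) (g 1 0 * vproj x + g 1 1) / (g 1 0 * autFactor g x) := by
  have hF' := autFactor_ofReal g x
  have hF : (autFactor g x : ℂ) ≠ 0 := by exact_mod_cast (autFactor_pos g x).ne'
  have hv : vproj (act g x) = ((g 0 0 * vproj x + g 0 1) *
      (starRingEnd ℂ) (g 1 0 * vproj x + g 1 1)
      + g 0 0 * (starRingEnd ℂ) (g 1 0) * (height x : ℂ) ^ 2) / (autFactor g x : ℂ) := rfl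
  rw [hv]
  generalize (starRingEnd ℂ) (g 1 0 * vproj x + g 1 1) = v at hF' ⊢
  field_simp
  rw [hF']
  linear_combination (-v) * det_eq g

theorem endsAt_rayTo (g : SL(2, ℂ)) (x : H3) :
    EndsAt (rayTo g x) (bact g⁻¹ OnePoint.infty) := by
  have hY := height_pos (act g x)
  rw [bact_infty]
  split_ifs with hc
  · rw [endsAt_infty_iff]
    have hA : ∀ t, autFactor g⁻¹ (vray (act g x) t) = ‖g⁻¹ 1 1‖ ^ 2 := fun t => by
      simp [autFactor, hc]
    have hpos : 0 < ‖g⁻¹ 1 1‖ ^ 2 := by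
      rw [← hA 0]; exact autFactor_pos _ _
    have h1 : Tendsto (fun t => (height (act g x) / ‖g⁻¹ 1 1‖ ^ 2 * Real.exp t) ^ 2)
        atTop atTop :=
      (tendsto_pow_atTop two_ne_zero).comp
        (Real.tendsto_exp_atTop.const_mul_atTop (div_pos hY hpos))
    refine tendsto_atTop_mono (fun t => ?_) h1
    have : height (rayTo g x t) = height (act g x) / ‖g⁻¹ 1 1‖ ^ 2 * Real.exp t := by
      rw [rayTo, height_act, hA, height_vray]
      ring
    rw [this]
    nlinarith [sq_nonneg ‖vproj (rayTo g x t)‖]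
  · rw [endsAt_coe_iff]
    have hc' : 0 < ‖g⁻¹ 1 0‖ := norm_pos_iff.mpr hc
    have hexp : Tendsto (fun t => height (act g x) * Real.exp t) atTop atTop :=
      Real.tendsto_exp_atTop.const_mul_atTop hY
    have hlow : ∀ t, ‖g⁻¹ 1 0‖ ^ 2 * (height (act g x) * Real.exp t) ^ 2 ≤
        autFactor g⁻¹ (vray (act g x) t) := fun t => by
      simp only [autFactor, vproj_vray, height_vray]
      nlinarith [sq_nonneg ‖g⁻¹ 1 0 * vproj (act g x) + g⁻¹ 1 1‖]
    have hF : Tendsto (fun t => autFactor g⁻¹ (vray (act g x) t)) atTop atTop :=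
      tendsto_atTop_mono hlow
        (((tendsto_pow_atTop two_ne_zero).comp hexp).const_mul_atTop (by positivity))
    constructor
    · have h0 : Tendsto (fun t => (starRingEnd ℂ) (g⁻¹ 1 0 * vproj (act g x) + g⁻¹ 1 1) /
          (g⁻¹ 1 0 * autFactor g⁻¹ (vray (act g x) t))) atTop (𝓝 0) := by
        rw [tendsto_zero_iff_norm_tendsto_zero]
        have : ∀ t, ‖(starRingEnd ℂ) (g⁻¹ 1 0 * vproj (act g x) + g⁻¹ 1 1) /
          (g⁻¹ 1 0 * autFactor g⁻¹ (vray (act g x) t))‖ =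
          ‖(starRingEnd ℂ) (g⁻¹ 1 0 * vproj (act g x) + g⁻¹ 1 1)‖ /
          (‖g⁻¹ 1 0‖ * autFactor g⁻¹ (vray (act g x) t)) := fun t => by
          rw [norm_div, norm_mul, Complex.norm_of_nonneg (autFactor_pos _ _).le]
        simp only [this]
        exact (hF.const_mul_atTop hc').const_div_atTop _
      have h1 := (tendsto_const_nhds (x := g⁻¹ 0 0 / g⁻¹ 1 0)).sub h0
      rw [sub_zero] at h1
      refine h1.congr fun t => ?_
      rw [rayTo, vproj_act _ _ hc, vproj_vray]
    · have hbound : ∀ t, height (rayTo g x t) ≤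
          (‖g⁻¹ 1 0‖ ^ 2)⁻¹ / (height (act g x) * Real.exp t) := fun t => by
        rw [rayTo, height_act, height_vray, div_le_div_iff₀ (autFactor_pos _ _) (by positivity),
          inv_mul_eq_div, le_div_iff₀ (by positivity)]
        nlinarith [hlow t]
      exact squeeze_zero (fun t => (height_pos _).le) hbound (hexp.const_div_atTop _)

theorem EndsAt.act_infty {ρ : ℝ → H3} {g : SL(2, ℂ)} (h : EndsAt ρ (bact g⁻¹ OnePoint.infty)) :
    EndsAt (fun t => act g (ρ t)) OnePoint.infty := by
  obtain ⟨e00, e01, e10, e11⟩ := inv_entries g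
  have hdet := det_eq g
  rw [endsAt_infty_iff]
  rw [bact_infty] at h
  split_ifs at h with hc
  · rw [endsAt_infty_iff] at h
    rw [e10, neg_eq_zero] at hc
    have ha : 0 < ‖g 0 0‖ := by
      rw [norm_pos_iff]
      rintro h0
      simp [h0, hc] at hdet
    have key : ∀ y, ‖vproj (act g⁻¹ y)‖ ^ 2 + height (act g⁻¹ y) ^ 2 ≤
        (2 * ‖g 0 1‖ ^ 2 + 2 * ‖g 1 1‖ ^ 2 * (‖vproj y‖ ^ 2 + height y ^ 2)) / ‖g 0 0‖ ^ 2 := by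
      intro y
      have hA : autFactor g⁻¹ y = ‖g 0 0‖ ^ 2 := by simp [autFactor, e10, e11, hc]
      rw [norm_sq_act, hA, e00, e01]
      apply div_le_div_of_nonneg_right _ (by positivity)
      have h1 := norm_add_le (g 1 1 * vproj y) (-g 0 1)
      rw [norm_neg, norm_mul] at h1
      have h2 : ‖g 1 1 * vproj y + -g 0 1‖ ^ 2 ≤ (‖g 1 1‖ * ‖vproj y‖ + ‖g 0 1‖) ^ 2 := by
        gcongr
      nlinarith [sq_nonneg (‖g 1 1‖ * ‖vproj y‖ - ‖g 0 1‖), sq_nonneg (‖g 1 1‖ * height y)]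
    have hd : 0 < ‖g 1 1‖ := by
      rw [norm_pos_iff]
      rintro h0
      simp [h0, hc] at hdet
    rw [tendsto_atTop] at h ⊢
    intro b
    filter_upwards [h ((2 * ‖g 0 1‖ ^ 2 + 2 * ‖g 1 1‖ ^ 2 * b) / ‖g 0 0‖ ^ 2)] with t ht
    have := ht.trans ((act_inv_act g (ρ t)) ▸ key (act g (ρ t)))
    rw [div_le_div_iff_of_pos_right (by positivity)] at this
    have h2 : 0 < 2 * ‖g 1 1‖ ^ 2 := by positivity
    nlinarith
  · rw [endsAt_coe_iff, e00, e10] at h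
    rw [e10, neg_eq_zero] at hc
    obtain ⟨h1, h2⟩ := h
    simp only [norm_sq_act]
    have hden : Tendsto (fun t => autFactor g (ρ t)) atTop (𝓝[>] 0) := by
      rw [tendsto_nhdsWithin_iff]
      refine ⟨?_, Eventually.of_forall fun t => autFactor_pos _ _⟩
      have := (((h1.const_mul (g 1 0)).add_const (g 1 1)).norm.pow 2).add
        ((h2.pow 2).const_mul (‖g 1 0‖ ^ 2))
      have h0 : g 1 0 * (g 1 1 / -g 1 0) + g 1 1 = 0 := by
        field_simp
        ring
      rw [h0] at this
      simpa [autFactor] using this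
    have hnum := (((h1.const_mul (g 0 0)).add_const (g 0 1)).norm.pow 2).add
        ((h2.pow 2).const_mul (‖g 0 0‖ ^ 2))
    have h0 : g 0 0 * (g 1 1 / -g 1 0) + g 0 1 = -1 / g 1 0 := by
      field_simp
      linear_combination -hdet
    rw [h0] at hnum
    refine Tendsto.pos_mul_atTop ?_ hnum (tendsto_inv_nhdsGT_zero.comp hden)
    have : 0 < ‖g 1 0‖ := norm_pos_iff.mpr hc
    simp only [norm_div, norm_neg, norm_one]
    positivity

/-- A geodesic ray ending at `∞` is vertical: the ratio `cosh (t - s) / cosh t` of the hyperbolic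
cosines of its distances to `ρ s` and `ρ 0` tends to `exp (-s)`, and also to the ratio of the
heights of `ρ 0` and `ρ s`. -/
theorem IsGeodesicRay.eq_vray {ρ : ℝ → H3} (hρ : IsGeodesicRay ρ)
    (hend : EndsAt ρ OnePoint.infty) {s : ℝ} (hs : 0 ≤ s) : ρ s = vray (ρ 0) s := by
  rw [endsAt_infty_iff] at hend
  have hcosh : ∀ r t, 0 ≤ r → 0 ≤ t → ‖vproj (ρ t) - vproj (ρ r)‖ ^ 2 + height (ρ t) ^ 2 +
      height (ρ r) ^ 2 = Real.cosh (t - r) * (2 * height (ρ t) * height (ρ r)) := by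
    intro r t hr ht
    have h := cosh_hdist (ρ t) (ρ r)
    rw [hρ t r ht hr, Real.cosh_abs] at h
    have := height_pos (ρ t)
    have := height_pos (ρ r)
    rw [h]
    field_simp
  -- the quotient of the squared distance to a fixed point by the squared norm tends to `1`
  have hone : ∀ r, Tendsto (fun t => (‖vproj (ρ t) - vproj (ρ r)‖ ^ 2 + height (ρ t) ^ 2 +
      height (ρ r) ^ 2) / (‖vproj (ρ t)‖ ^ 2 + height (ρ t) ^ 2)) atTop (𝓝 1) := by
    intro r
    set B := ‖vproj (ρ r)‖ with hB
    have hB0 : 0 ≤ B := norm_nonneg _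
    have hsqrt : Tendsto (fun t => √(‖vproj (ρ t)‖ ^ 2 + height (ρ t) ^ 2)) atTop atTop :=
      Real.tendsto_sqrt_atTop.comp hend
    have h0 : Tendsto (fun t => 2 * B / √(‖vproj (ρ t)‖ ^ 2 + height (ρ t) ^ 2) +
        (B ^ 2 + height (ρ r) ^ 2) / (‖vproj (ρ t)‖ ^ 2 + height (ρ t) ^ 2)) atTop (𝓝 0) := by
      simpa using (hsqrt.const_div_atTop (2 * B)).add
        (hend.const_div_atTop (B ^ 2 + height (ρ r) ^ 2))
    rw [← tendsto_sub_nhds_zero_iff]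
    refine squeeze_zero_norm (fun t => ?_) h0
    have hN : 0 < ‖vproj (ρ t)‖ ^ 2 + height (ρ t) ^ 2 := by
      have := height_pos (ρ t)
      positivity
    set N := ‖vproj (ρ t)‖ ^ 2 + height (ρ t) ^ 2 with hNdef
    have hS : 0 < √N := Real.sqrt_pos.mpr hN
    have hSS : √N * √N = N := Real.mul_self_sqrt hN.le
    have hle : ‖vproj (ρ t)‖ ≤ √N := by
      apply Real.le_sqrt_of_sq_le
      nlinarith [sq_nonneg (height (ρ t))]
    have h1 : ‖vproj (ρ t) - vproj (ρ r)‖ ≤ ‖vproj (ρ t)‖ + B := norm_sub_le _ _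
    have h2 : ‖vproj (ρ t)‖ - B ≤ ‖vproj (ρ t) - vproj (ρ r)‖ := norm_sub_norm_le _ _
    have h3 : B - ‖vproj (ρ t)‖ ≤ ‖vproj (ρ t) - vproj (ρ r)‖ := by
      rw [norm_sub_rev]; exact norm_sub_norm_le _ _
    have h4 : ‖vproj (ρ t) - vproj (ρ r)‖ ^ 2 ≤ (‖vproj (ρ t)‖ + B) ^ 2 := by gcongr
    have h5 : (‖vproj (ρ t)‖ - B) ^ 2 ≤ ‖vproj (ρ t) - vproj (ρ r)‖ ^ 2 := by
      rw [sq_le_sq, abs_of_nonneg (norm_nonneg (vproj (ρ t) - vproj (ρ r)))]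
      exact abs_le.mpr ⟨by linarith, by linarith⟩
    rw [Real.norm_eq_abs, div_sub_one hN.ne', abs_div, abs_of_pos hN,
      show 2 * B / √N = 2 * B * √N / N by
        rw [div_eq_div_iff hS.ne' hN.ne', mul_assoc (2 * B), hSS], ← add_div]
    gcongr
    have h6 : B * ‖vproj (ρ t)‖ ≤ B * √N := by gcongr
    rw [abs_le]
    constructor <;> nlinarith [sq_nonneg (height (ρ r))]
  have hratio : Tendsto (fun t => Real.cosh (t - s) / Real.cosh t) atTop
      (𝓝 (height (ρ 0) / height (ρ s))) := by
    have h := ((hone s).div (hone 0) one_ne_zero).mul_const (height (ρ 0) / height (ρ s))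
    rw [div_one, one_mul] at h
    refine h.congr' ?_
    filter_upwards [eventually_ge_atTop 0] with t ht
    have hN : 0 < ‖vproj (ρ t)‖ ^ 2 + height (ρ t) ^ 2 := by
      have := height_pos (ρ t)
      positivity
    have h1 := height_pos (ρ t)
    have h2 := height_pos (ρ s)
    have h3 := height_pos (ρ 0)
    have h4 := Real.cosh_pos t
    simp only [Pi.div_apply]
    rw [hcosh s t hs ht, hcosh 0 t le_rfl ht, sub_zero]
    field_simp
  have hratio' : Tendsto (fun t => Real.cosh (t - s) / Real.cosh t) atTop
      (𝓝 (Real.exp (-s))) := by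
    have hneg : Tendsto (fun t : ℝ => Real.exp (-(2 * t))) atTop (𝓝 0) :=
      Real.tendsto_exp_neg_atTop_nhds_zero.comp (tendsto_id.const_mul_atTop two_pos)
    have h := ((hneg.const_mul (Real.exp s)).const_add (Real.exp (-s))).div
      (hneg.const_add 1) (by norm_num)
    simp only [mul_zero, add_zero, div_one] at h
    refine h.congr fun t => ?_
    have h1 : Real.exp (-(2 * t)) = (Real.exp t)⁻¹ * (Real.exp t)⁻¹ := by
      rw [← Real.exp_neg, ← Real.exp_add]
      ring_nf
    have := Real.exp_pos t
    have := Real.exp_pos s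
    simp only [Pi.div_apply]
    rw [Real.cosh_eq, Real.cosh_eq, neg_sub, Real.exp_sub, Real.exp_sub, h1, Real.exp_neg,
      Real.exp_neg]
    field_simp
  have heq := tendsto_nhds_unique hratio hratio'
  have h0 := height_pos (ρ 0)
  have hS := height_pos (ρ s)
  have hexp := Real.exp_pos s
  have hh : height (ρ s) = height (ρ 0) * Real.exp s := by
    rw [Real.exp_neg] at heq
    field_simp at heq
    linarith
  refine H3.ext ?_ hh
  have h := hcosh 0 s le_rfl hs
  rw [sub_zero, Real.cosh_eq, Real.exp_neg, hh] at h
  have h' : ‖vproj (ρ s) - vproj (ρ 0)‖ ^ 2 = 0 := by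
    field_simp at h
    linarith
  rw [vproj_vray]
  exact sub_eq_zero.mp (norm_eq_zero.mp (pow_eq_zero_iff two_ne_zero |>.mp h'))

/-- A geodesic ray is determined by its origin and its endpoint. -/
theorem IsGeodesicRay.eq_rayTo {ρ : ℝ → H3} (hρ : IsGeodesicRay ρ) {g : SL(2, ℂ)}
    (hend : EndsAt ρ (bact g⁻¹ OnePoint.infty)) {s : ℝ} (hs : 0 ≤ s) :
    ρ s = rayTo g (ρ 0) s := by
  have h : IsGeodesicRay fun t => act g (ρ t) := fun s t hs ht => by
    rw [hdist_act, hρ s t hs ht]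
  rw [rayTo, ← h.eq_vray hend.act_infty hs, act_inv_act]

/-! ### Nearest ends as minima of automorphy factors -/

/-- The ray from `x` to `g⁻¹ ∞` is the shortest way to the cusp: `g` brings `x` as high as
possible among the elements of `Γ`. -/
structure IsNearest (Γ : Subgroup SL(2, ℂ)) (g : SL(2, ℂ)) (x : H3) : Prop where
  mem : g ∈ Γ
  le : ∀ h ∈ Γ, autFactor g x ≤ autFactor h x

variable {Γ : Subgroup SL(2, ℂ)}

theorem IsMinimizingRay.eq_rayTo {g : SL(2, ℂ)} {x : H3} {ρ : ℝ → H3}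
    (h : IsMinimizingRay Γ x (bact g⁻¹ OnePoint.infty) ρ) {s : ℝ} (hs : 0 ≤ s) :
    ρ s = rayTo g x s := by
  rw [h.geodesic.eq_rayTo h.endsAt hs, h.start]

theorem orbDist_le (Γ : Subgroup SL(2, ℂ)) (x y : H3) {g : SL(2, ℂ)} (hg : g ∈ Γ) :
    orbDist Γ x y ≤ hdist x (act g y) :=
  ciInf_le (f := fun g : Γ => hdist x (act g y))
    ⟨0, by rintro _ ⟨g, rfl⟩; exact hdist_nonneg _ _⟩ ⟨g, hg⟩

theorem le_orbDist {x y : H3} {r : ℝ} (h : ∀ g ∈ Γ, r ≤ hdist x (act g y)) :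
    r ≤ orbDist Γ x y :=
  le_ciInf fun g => h g g.2

theorem autFactor_vray_le (g : SL(2, ℂ)) (x : H3) {s : ℝ} (hs : 0 ≤ s) :
    autFactor g x ≤ autFactor g (vray x s) := by
  have h1 : 1 ≤ Real.exp s := Real.one_le_exp hs
  have h2 := height_pos x
  simp only [autFactor, vproj_vray, height_vray]
  gcongr
  nlinarith

theorem IsNearest.rayTo {g : SL(2, ℂ)} {x : H3} (h : IsNearest Γ g x) {s : ℝ} (hs : 0 ≤ s) :
    IsNearest Γ g (rayTo g x s) := by
  have key : ∀ k ∈ Γ, autFactor k (HypOrb.rayTo g x s) =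
      autFactor (k * g⁻¹) (vray (act g x) s) * autFactor g (HypOrb.rayTo g x s) := fun k _ => by
    rw [← act_rayTo, ← autFactor_mul, inv_mul_cancel_right]
  refine ⟨h.mem, fun k hk => ?_⟩
  rw [key k hk]
  have h1 := h.le k hk
  rw [show autFactor k x = autFactor (k * g⁻¹) (act g x) * autFactor g x by
    rw [← autFactor_mul, inv_mul_cancel_right]] at h1
  have h2 : 1 ≤ autFactor (k * g⁻¹) (act g x) := by
    have := autFactor_pos g x
    by_contra! hlt
    nlinarith
  have h3 := h2.trans (autFactor_vray_le (k * g⁻¹) (act g x) hs)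
  have := autFactor_pos g (HypOrb.rayTo g x s)
  nlinarith

theorem IsNearest.height_le {g : SL(2, ℂ)} {x : H3} (h : IsNearest Γ g x) {k : SL(2, ℂ)}
    (hk : k ∈ Γ) : height (act k x) ≤ height (act g x) := by
  rw [height_act, height_act]
  exact div_le_div_of_nonneg_left (height_pos x).le (autFactor_pos g x) (h.le k hk)

theorem log_height_vray (x : H3) (s : ℝ) :
    Real.log (height (vray x s)) = Real.log (height x) + s := by
  rw [height_vray, Real.log_mul (height_pos x).ne' (Real.exp_pos s).ne', Real.log_exp]

/-- Heights bound distances from below: no element of `Γ` brings a point of the ray higher than `g`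
does, so no path in the quotient is shorter than the ray. -/
theorem IsNearest.isMinimizingRay {g : SL(2, ℂ)} {x : H3} (h : IsNearest Γ g x) :
    IsMinimizingRay Γ x (bact g⁻¹ OnePoint.infty) (HypOrb.rayTo g x) := by
  refine ⟨rayTo_zero g x, isGeodesicRay_rayTo g x, endsAt_rayTo g x, ⟨g⁻¹, Γ.inv_mem h.mem, rfl⟩,
    fun s t hs ht => le_antisymm ?_ (le_orbDist fun k hk => ?_)⟩
  · rw [← isGeodesicRay_rayTo g x s t hs ht]
    have := orbDist_le Γ (HypOrb.rayTo g x s) (HypOrb.rayTo g x t) Γ.one_mem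
    rwa [act_one] at this
  · have h1 : ∀ u v, 0 ≤ u → ∀ m ∈ Γ, v - u ≤
        hdist (act m (HypOrb.rayTo g x u)) (act g (HypOrb.rayTo g x v)) := by
      intro u v hu m hm
      have h2 := abs_log_height_le_hdist (act m (HypOrb.rayTo g x u)) (act g (HypOrb.rayTo g x v))
      have h3 := Real.log_le_log (height_pos _) ((h.rayTo hu).height_le hm)
      rw [act_rayTo, log_height_vray] at h2 h3
      rw [act_rayTo]
      linarith [(abs_le.mp h2).1]
    rw [abs_le']
    constructor
    · have := h1 t s ht (g * k) (Γ.mul_mem h.mem hk)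
      rw [act_mul, hdist_act] at this
      rw [show hdist (HypOrb.rayTo g x s) (act k (HypOrb.rayTo g x t)) =
        hdist (act k (HypOrb.rayTo g x t)) (HypOrb.rayTo g x s) by
          apply eq_of_cosh_eq (hdist_nonneg _ _) (hdist_nonneg _ _)
          rw [cosh_hdist, cosh_hdist, norm_sub_rev]
          ring]
      exact this
    · rw [neg_sub]
      have := h1 s t hs (g * k⁻¹) (Γ.mul_mem h.mem (Γ.inv_mem hk))
      rw [act_mul, hdist_act] at this
      rwa [← hdist_act k⁻¹, act_inv_act]

/-- Conversely, if `k` brought the origin of the ray higher than `g`, then for large `t` its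
distance in the quotient to the point of parameter `t` would be less than `t`. -/
theorem isNearest_of_isMinimizingRay {g : SL(2, ℂ)} {x : H3} {ρ : ℝ → H3} (hg : g ∈ Γ)
    (h : IsMinimizingRay Γ x (bact g⁻¹ OnePoint.infty) ρ) : IsNearest Γ g x := by
  refine ⟨hg, fun k hk => ?_⟩
  set X := act k x with hX
  set Y := act g x with hY
  have hx := height_pos x
  have hXp := height_pos X
  have hYp := height_pos Y
  have h1 : ∀ t, 0 ≤ t → t ≤ hdist X (vray Y t) := by
    intro t ht
    have := h.minimizing 0 t le_rfl ht
    rw [h.eq_rayTo le_rfl, h.eq_rayTo ht, rayTo_zero, zero_sub, abs_neg, abs_of_nonneg ht] at this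
    have h' := orbDist_le Γ x (rayTo g x t) (Γ.mul_mem (Γ.inv_mem hk) hg)
    rwa [this, act_mul, act_rayTo, ← hdist_act k, act_act_inv] at h'
  -- the height of `X` cannot exceed that of `Y`, as `t ≤ d (X, vray Y t)` for large `t`
  have h2 : height X ≤ height Y := by
    by_contra! hlt
    set D := ‖vproj X - vproj Y‖ ^ 2 + height X ^ 2 with hD
    have hlim : Tendsto (fun t => height Y * (height X - height Y) * Real.exp t) atTop atTop :=
      Real.tendsto_exp_atTop.const_mul_atTop (mul_pos hYp (by linarith))
    obtain ⟨t, ht0, ht⟩ := ((eventually_ge_atTop 0).and (hlim.eventually_gt_atTop D)).exists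
    have h3 : Real.cosh t ≤ Real.cosh (hdist X (vray Y t)) := by
      rw [Real.cosh_le_cosh, abs_of_nonneg ht0, abs_of_nonneg (hdist_nonneg _ _)]
      exact h1 t ht0
    have hexp : 1 ≤ Real.exp t := Real.one_le_exp ht0
    have hneg := Real.exp_pos (-t)
    rw [cosh_hdist, vproj_vray, height_vray, Real.cosh_eq, le_div_iff₀ (by positivity)] at h3
    have h4 : (Real.exp t + Real.exp (-t)) / 2 * (2 * height X * (height Y * Real.exp t)) ≥
        height X * height Y * Real.exp t ^ 2 := by
      have : 0 ≤ Real.exp (-t) * (height X * height Y * Real.exp t) := by positivity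
      nlinarith
    have h5 : height Y * (height X - height Y) * Real.exp t ≤
        height Y * (height X - height Y) * Real.exp t * Real.exp t := by
      have : 0 ≤ height Y * (height X - height Y) * Real.exp t :=
        mul_nonneg (mul_nonneg hYp.le (by linarith)) (by positivity)
      nlinarith
    nlinarith
  rw [hX, hY, height_act, height_act,
    div_le_div_iff_of_pos_left hx (autFactor_pos _ _) (autFactor_pos _ _)] at h2
  exact h2

/-- The nearest ends of `x` are the points `g⁻¹ ∞` for which `g` minimizes the automorphy factor. -/
theorem mem_nearestEnds_iff {x : H3} {p : OnePoint ℂ} :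
    p ∈ nearestEnds Γ x ↔ ∃ g, IsNearest Γ g x ∧ p = bact g⁻¹ OnePoint.infty := by
  constructor
  · rintro ⟨ρ, hρ⟩
    obtain ⟨g, hg, rfl⟩ := hρ.orbit
    refine ⟨g⁻¹, isNearest_of_isMinimizingRay (Γ.inv_mem hg) (ρ := ρ) ?_, ?_⟩ <;> rw [inv_inv]
    exact hρ
  · rintro ⟨g, hg, rfl⟩
    exact ⟨_, hg.isMinimizingRay⟩

theorem lower_left_eq_zero_iff (g : SL(2, ℂ)) :
    g 1 0 = 0 ↔ bact g OnePoint.infty = OnePoint.infty := by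
  rw [bact_infty]
  split_ifs with h <;> simp [h]

theorem entries_of_bact_eq_add {g : SL(2, ℂ)} {b : ℂ}
    (h : ∀ z : ℂ, bact g z = ((z + b : ℂ) : OnePoint ℂ)) :
    g 1 0 = 0 ∧ g 0 0 = g 1 1 ∧ g 0 1 = b * g 1 1 ∧ g 1 1 ^ 2 = 1 := by
  have hdet := det_eq g
  have hc : g 1 0 = 0 := by
    by_contra hc
    have h' := h (-(g 1 1 / g 1 0))
    rw [bact_coe, if_pos (by field_simp; ring)] at h'
    exact OnePoint.infty_ne_coe _ h'
  have hd : g 1 1 ≠ 0 := by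
    rintro h0
    simp [h0, hc] at hdet
  have h0 := h 0
  have h1 := h 1
  rw [bact_coe, if_neg (by simpa [hc] using hd), OnePoint.coe_eq_coe] at h0 h1
  simp only [hc, mul_zero, zero_add, mul_one, sub_zero] at h0 h1 hdet
  rw [div_eq_iff hd] at h0 h1
  have ha : g 0 0 = g 1 1 := by linear_combination h1 - h0
  exact ⟨hc, ha, h0, by rw [ha] at hdet; rw [sq, hdet]⟩

theorem StabilizerIsTranslations.autFactor_eq_one (htrans : StabilizerIsTranslations Γ)
    {k : SL(2, ℂ)} (hk : k ∈ Γ) (hfix : bact k OnePoint.infty = OnePoint.infty) (x : H3) :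
    autFactor k x = 1 := by
  obtain ⟨b, hb⟩ := htrans k hk hfix
  obtain ⟨hc, -, -, h2⟩ := entries_of_bact_eq_add hb
  have h3 : ‖k 1 1‖ ^ 2 = 1 := by rw [← norm_pow, h2, norm_one]
  simp [autFactor, hc, h3]

/-- The automorphy factor of `g ∈ Γ` depends only on the point `g⁻¹ ∞`. -/
theorem StabilizerIsTranslations.autFactor_congr (htrans : StabilizerIsTranslations Γ)
    {g g' : SL(2, ℂ)} (hg : g ∈ Γ) (hg' : g' ∈ Γ)
    (h : bact g⁻¹ OnePoint.infty = bact g'⁻¹ OnePoint.infty) (x : H3) :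
    autFactor g x = autFactor g' x := by
  have h1 := htrans.autFactor_eq_one (Γ.mul_mem hg (Γ.inv_mem hg'))
    (by rw [bact_mul, ← h, bact_bact_inv]) (act g' x)
  have h2 := autFactor_mul (g * g'⁻¹) g' x
  rwa [inv_mul_cancel_right, h1, one_mul] at h2

theorem StabilizerIsTranslations.mem_nearestEnds_iff (htrans : StabilizerIsTranslations Γ)
    {g : SL(2, ℂ)} (hg : g ∈ Γ) {x : H3} :
    bact g⁻¹ OnePoint.infty ∈ nearestEnds Γ x ↔ IsNearest Γ g x := by
  rw [HypOrb.mem_nearestEnds_iff]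
  constructor
  · rintro ⟨g', hg', h⟩
    exact ⟨hg, fun k hk => (htrans.autFactor_congr hg hg'.mem h x).trans_le (hg'.le k hk)⟩
  · exact fun h => ⟨g, h, rfl⟩

/-! ### Local finiteness -/

theorem exists_translation (hcusp : IsParabolicPoint Γ OnePoint.infty) :
    ∃ u ∈ Γ, u 0 0 = 1 ∧ u 0 1 ≠ 0 ∧ u 1 0 = 0 ∧ u 1 1 = 1 := by
  obtain ⟨g, hg, hpar, hfix⟩ := hcusp
  have hc := (lower_left_eq_zero_iff g).mpr hfix
  obtain ⟨h1, h2⟩ := (isParabolic_iff_of_upperTriangular hc).mp hpar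
  have hdet := det_eq g
  rw [hc, ← h1, mul_zero, sub_zero] at hdet
  have h0 : g 0 0 ≠ 0 := by
    rintro h0
    simp [h0] at hdet
  refine ⟨g * g, Γ.mul_mem hg hg, ?_, ?_, ?_, ?_⟩ <;>
    simp only [Matrix.SpecialLinearGroup.coe_mul, Matrix.mul_apply, Fin.sum_univ_two]
  · rw [hc, hdet]; ring
  · rw [← h1, show g 0 0 * g 0 1 + g 0 1 * g 0 0 = 2 * (g 0 0 * g 0 1) by ring]
    exact mul_ne_zero two_ne_zero (mul_ne_zero h0 h2)
  · rw [hc]; ring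
  · rw [hc, ← h1, hdet]; ring

theorem finite_bounded_entries (hd : DiscreteTopology Γ) (M : ℝ) :
    {g : SL(2, ℂ) | g ∈ Γ ∧ ∀ i j, ‖g i j‖ ≤ M}.Finite := by
  have hcl : IsClosed (Γ : Set SL(2, ℂ)) := Subgroup.isClosed_of_discrete
  have hK : IsCompact {g : SL(2, ℂ) | ∀ i j, ‖g i j‖ ≤ M} := by
    have hm : IsCompact {m : Fin 2 → Fin 2 → ℂ | ∀ i j, ‖m i j‖ ≤ M} := by
      have := isCompact_univ_pi fun _ : Fin 2 => isCompact_univ_pi fun _ : Fin 2 =>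
        isCompact_closedBall (0 : ℂ) M
      convert this using 1
      ext m
      simp [Set.mem_pi]
    exact Matrix.SpecialLinearGroup.isClosedEmbedding_val.isCompact_preimage hm
  have h := (hK.inter_left hcl).finite
    ((isDiscrete_iff_discreteTopology.mpr hd).mono inter_subset_left)
  exact h

theorem finite_setOf_sq_mem {s : Set ℂ} (hs : s.Finite) : {z : ℂ | z ^ 2 ∈ s}.Finite := by
  refine hs.preimage' (f := fun z : ℂ => z ^ 2) fun w _ => ?_
  have h : ((Polynomial.nthRoots 2 w).toFinset : Set ℂ).Finite := Finset.finite_toSet _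
  refine h.subset fun z hz => ?_
  simpa [Polynomial.mem_nthRoots two_pos] using hz

/-- The bottom rows `(c, d)` of the elements `g` of `Γ` form a locally finite set: for a
translation `u ∈ Γ` by `b ≠ 0`, the off-diagonal entries of `g⁻¹ * u * g` are `b * d ^ 2` and
`-b * c ^ 2`, and its diagonal entries are `1 ± b * c * d`, so that discreteness leaves finitely
many values of `c ^ 2` and `d ^ 2`. -/
theorem finite_bounded_rows (hd : DiscreteTopology Γ)
    (hcusp : IsParabolicPoint Γ OnePoint.infty) (M : ℝ) :
    {r : ℂ × ℂ | ∃ g ∈ Γ, r = (g 1 0, g 1 1) ∧ ‖g 1 0‖ ≤ M ∧ ‖g 1 1‖ ≤ M}.Finite := by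
  obtain ⟨u, hu, u00, u01, u10, u11⟩ := exists_translation hcusp
  set b := u 0 1 with hb
  have hfin := finite_bounded_entries hd (1 + ‖b‖ * M ^ 2)
  have hC := finite_setOf_sq_mem (hfin.image fun k => -(k 1 0) / b)
  have hD := finite_setOf_sq_mem (hfin.image fun k => k 0 1 / b)
  refine (hC.prod hD).subset ?_
  rintro _ ⟨g, hg, rfl, hcM, hdM⟩
  obtain ⟨e00, e01, e10, e11⟩ := inv_entries g
  have hdet := det_eq g
  set k := g⁻¹ * u * g with hk
  have k00 : k 0 0 = 1 + b * (g 1 0 * g 1 1) := by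
    simp only [hk, Matrix.SpecialLinearGroup.coe_mul, Matrix.mul_apply, Fin.sum_univ_two, e00, e01,
      u00, u10, u11, ← hb]
    linear_combination hdet
  have k01 : k 0 1 = b * g 1 1 ^ 2 := by
    simp only [hk, Matrix.SpecialLinearGroup.coe_mul, Matrix.mul_apply, Fin.sum_univ_two, e00, e01,
      u00, u10, u11, ← hb]
    ring
  have k10 : k 1 0 = -(b * g 1 0 ^ 2) := by
    simp only [hk, Matrix.SpecialLinearGroup.coe_mul, Matrix.mul_apply, Fin.sum_univ_two, e10, e11,
      u00, u10, u11, ← hb]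
    ring
  have k11 : k 1 1 = 1 - b * (g 1 0 * g 1 1) := by
    simp only [hk, Matrix.SpecialLinearGroup.coe_mul, Matrix.mul_apply, Fin.sum_univ_two, e10, e11,
      u00, u10, u11, ← hb]
    linear_combination hdet
  have hM : 0 ≤ M := (norm_nonneg _).trans hcM
  have hprod : ∀ x y : ℂ, ‖x‖ ≤ M → ‖y‖ ≤ M → ‖b * (x * y)‖ ≤ ‖b‖ * M ^ 2 := by
    intro x y hx hy
    rw [norm_mul, norm_mul, sq]
    gcongr
  have hkmem : k ∈ {g : SL(2, ℂ) | g ∈ Γ ∧ ∀ i j, ‖g i j‖ ≤ 1 + ‖b‖ * M ^ 2} := by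
    refine ⟨Γ.mul_mem (Γ.mul_mem (Γ.inv_mem hg) hu) hg, ?_⟩
    have hpos : 0 ≤ ‖b‖ * M ^ 2 := by positivity
    intro i j
    fin_cases i <;> fin_cases j <;> simp only [Fin.zero_eta, Fin.mk_one]
    · rw [k00]
      exact (norm_add_le _ _).trans (by rw [norm_one]; linarith [hprod _ _ hcM hdM])
    · rw [k01, sq]
      linarith [hprod _ _ hdM hdM]
    · rw [k10, norm_neg, sq]
      linarith [hprod _ _ hcM hcM]
    · rw [k11]
      exact (norm_sub_le _ _).trans (by rw [norm_one]; linarith [hprod _ _ hcM hdM])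
  refine ⟨⟨k, hkmem, ?_⟩, ⟨k, hkmem, ?_⟩⟩
  · simp only [k10]
    field_simp
  · simp only [k01]
    field_simp

/-- The automorphy factor of a matrix with bottom row `r`. -/
noncomputable def rowFactor (r : ℂ × ℂ) (x : H3) : ℝ :=
  ‖r.1 * vproj x + r.2‖ ^ 2 + ‖r.1‖ ^ 2 * height x ^ 2

theorem rowFactor_row (g : SL(2, ℂ)) (x : H3) : rowFactor (g 1 0, g 1 1) x = autFactor g x := rfl

theorem continuous_rowFactor (r : ℂ × ℂ) : Continuous (rowFactor r) := by
  have h1 := continuous_vproj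
  have h2 := continuous_height
  unfold rowFactor
  fun_prop

theorem finite_rows_of_autFactor_le (hd : DiscreteTopology Γ)
    (hcusp : IsParabolicPoint Γ OnePoint.infty) (C : ℝ) {δ : ℝ} (hδ : 0 < δ) (M : ℝ) :
    {r : ℂ × ℂ | ∃ g ∈ Γ, r = (g 1 0, g 1 1) ∧
      ∃ x, ‖vproj x‖ ≤ C ∧ δ ≤ height x ∧ autFactor g x ≤ M}.Finite := by
  refine (finite_bounded_rows hd hcusp (max (√M / δ) (√M + √M / δ * C))).subset ?_
  rintro _ ⟨g, hg, rfl, x, hxC, hxδ, hM⟩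
  have hC : 0 ≤ C := (norm_nonneg _).trans hxC
  have hM0 : 0 ≤ M := (autFactor_pos g x).le.trans hM
  have h1 : ‖g 1 0‖ ≤ √M / δ := by
    rw [le_div_iff₀ hδ]
    apply Real.le_sqrt_of_sq_le
    have : (‖g 1 0‖ * δ) ^ 2 ≤ (‖g 1 0‖ * height x) ^ 2 := by gcongr
    unfold autFactor at hM
    nlinarith [sq_nonneg ‖g 1 0 * vproj x + g 1 1‖]
  have h2 : ‖g 1 0 * vproj x + g 1 1‖ ≤ √M := by
    apply Real.le_sqrt_of_sq_le
    unfold autFactor at hM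
    nlinarith [sq_nonneg (‖g 1 0‖ * height x)]
  refine ⟨g, hg, rfl, h1.trans (le_max_left _ _), le_trans ?_ (le_max_right _ _)⟩
  calc ‖g 1 1‖ = ‖(g 1 0 * vproj x + g 1 1) - g 1 0 * vproj x‖ := by congr 1; ring
    _ ≤ ‖g 1 0 * vproj x + g 1 1‖ + ‖g 1 0‖ * ‖vproj x‖ := by
      rw [← norm_mul]; exact norm_sub_le _ _
    _ ≤ √M + √M / δ * C := by gcongr

theorem autFactor_one (x : H3) : autFactor 1 x = 1 := by simp [autFactor]

/-- Minima exist: only finitely many rows give a factor at most `1`, the factor of the identity. -/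
theorem exists_isNearest (hd : DiscreteTopology Γ)
    (hcusp : IsParabolicPoint Γ OnePoint.infty) (x : H3) : ∃ g, IsNearest Γ g x := by
  have hfin := finite_rows_of_autFactor_le hd hcusp ‖vproj x‖ (height_pos x) 1
  have h1 : (1 : SL(2, ℂ)) ∈ Γ := Γ.one_mem
  have hle := (autFactor_one x).le
  obtain ⟨_, ⟨g, hg, rfl, -⟩, hmin⟩ := Set.exists_min_image _ (fun r => rowFactor r x) hfin
    ⟨_, 1, h1, rfl, x, le_rfl, le_rfl, hle⟩
  refine ⟨g, hg, fun h hh => ?_⟩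
  rw [← rowFactor_row, ← rowFactor_row h]
  rcases le_total (autFactor h x) 1 with h2 | h2
  · exact hmin _ ⟨h, hh, rfl, x, le_rfl, le_rfl, h2⟩
  · have := hmin _ ⟨1, h1, rfl, x, le_rfl, le_rfl, hle⟩
    rw [rowFactor_row 1, autFactor_one] at this
    exact this.trans h2

theorem eventually_isNearest_imp (hd : DiscreteTopology Γ)
    (hcusp : IsParabolicPoint Γ OnePoint.infty) (x : H3) :
    ∀ᶠ y in 𝓝 x, ∀ g, IsNearest Γ g y → IsNearest Γ g x := by
  obtain ⟨g₀, hg₀⟩ := exists_isNearest hd hcusp x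
  have hfin := finite_rows_of_autFactor_le hd hcusp (‖vproj x‖ + 1) (half_pos (height_pos x))
    (autFactor g₀ x + 1)
  have h1 := (Filter.eventually_all_finite (l := 𝓝 x)
    (p := fun r y => autFactor g₀ x < rowFactor r x → autFactor g₀ y < rowFactor r y) hfin).mpr
    fun r _ => by
      by_cases hr : autFactor g₀ x < rowFactor r x
      · filter_upwards [(continuous_autFactor g₀).continuousAt.eventually_lt
          (continuous_rowFactor r).continuousAt hr] with y hy _ using hy
      · exact Eventually.of_forall fun y h => absurd h hr
  have h2 : ∀ᶠ y in 𝓝 x, ‖vproj y‖ < ‖vproj x‖ + 1 :=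
    continuous_vproj.norm.continuousAt.eventually_lt_const (lt_add_one _)
  have h3 : ∀ᶠ y in 𝓝 x, height x / 2 < height y :=
    continuous_height.continuousAt.eventually_const_lt (half_lt_self (height_pos x))
  have h4 : ∀ᶠ y in 𝓝 x, autFactor g₀ y < autFactor g₀ x + 1 :=
    (continuous_autFactor g₀).continuousAt.eventually_lt_const (lt_add_one _)
  filter_upwards [h1, h2, h3, h4] with y h1 h2 h3 h4 g hg
  have h5 := hg.le g₀ hg₀.mem
  have h6 := h1 (g 1 0, g 1 1) ⟨g, hg.mem, rfl, y, h2.le, h3.le, h5.trans h4.le⟩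
  refine ⟨hg.mem, fun h hh => le_trans ?_ (hg₀.le h hh)⟩
  by_contra! hlt
  exact absurd (h6 hlt) (not_lt.mpr h5)

theorem nearestEnds_nonempty (hd : DiscreteTopology Γ)
    (hcusp : IsParabolicPoint Γ OnePoint.infty) (x : H3) : (nearestEnds Γ x).Nonempty := by
  obtain ⟨g, hg⟩ := exists_isNearest hd hcusp x
  exact ⟨_, mem_nearestEnds_iff.mpr ⟨g, hg, rfl⟩⟩

/-- The set of nearest ends is upper semicontinuous. -/
theorem eventually_nearestEnds_subset (hd : DiscreteTopology Γ)
    (hcusp : IsParabolicPoint Γ OnePoint.infty) (x : H3) :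
    ∀ᶠ y in 𝓝 x, nearestEnds Γ y ⊆ nearestEnds Γ x := by
  filter_upwards [eventually_isNearest_imp hd hcusp x] with y hy p hp
  obtain ⟨g, hg, rfl⟩ := mem_nearestEnds_iff.mp hp
  exact mem_nearestEnds_iff.mpr ⟨g, hy g hg, rfl⟩

/-- Where the number of nearest ends is constant and finite, upper semicontinuity makes the set of
nearest ends locally constant. -/
theorem nearestEnds_eq_of_isPreconnected (hd : DiscreteTopology Γ)
    (hcusp : IsParabolicPoint Γ OnePoint.infty) {s : Set H3} (hs : IsPreconnected s) (n : ℕ)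
    (hn : ∀ x ∈ s, (nearestEnds Γ x).encard = n) {x y : H3} (hx : x ∈ s) (hy : y ∈ s) :
    nearestEnds Γ x = nearestEnds Γ y := by
  have hlc : IsLocallyConstant fun x : s => nearestEnds Γ x := by
    rw [IsLocallyConstant.iff_eventually_eq]
    intro x
    have h := (eventually_nearestEnds_subset hd hcusp x.1)
    filter_upwards [continuous_subtype_val.continuousAt.eventually h] with y hy
    refine (Set.finite_of_encard_eq_coe (hn y y.2)).eq_of_subset_of_encard_le hy ?_
    rw [hn x x.2, hn y y.2]
  have := isPreconnected_iff_preconnectedSpace.mp hs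
  exact hlc.apply_eq_of_preconnectedSpace ⟨x, hx⟩ ⟨y, hy⟩

/-! ### Geodesic segments and cells -/

/-- The geodesic segment from `x` to `y`, parametrized so that all automorphy factors are affine
functions of the parameter. -/
noncomputable def segment (x y : H3) (s : I) : H3 :=
  ⟨((1 - s : ℝ) * vproj x + (s : ℝ) * vproj y, √((1 - s) * height x ^ 2 + s * height y ^ 2 +
    s * (1 - s) * ‖vproj x - vproj y‖ ^ 2)), by
    have hx := height_pos x
    have hy := height_pos y
    have h0 := s.2.1
    have h1 : 0 ≤ 1 - (s : ℝ) := sub_nonneg.mpr s.2.2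
    refine Real.sqrt_pos.mpr ?_
    rcases h0.eq_or_lt with h | h
    · rw [← h]
      simp only [sub_zero, one_mul, zero_mul, add_zero]
      positivity
    · positivity⟩

theorem vproj_segment (x y : H3) (s : I) :
    vproj (segment x y s) = (1 - s : ℝ) * vproj x + (s : ℝ) * vproj y := rfl

theorem height_segment_sq (x y : H3) (s : I) : height (segment x y s) ^ 2 =
    (1 - s) * height x ^ 2 + s * height y ^ 2 + s * (1 - s) * ‖vproj x - vproj y‖ ^ 2 :=
  Real.sq_sqrt (Real.sqrt_pos.mp (segment x y s).2).le

theorem continuous_segment (x y : H3) : Continuous (segment x y) := by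
  unfold segment
  refine Continuous.subtype_mk (Continuous.prodMk ?_ ?_) _ <;> fun_prop

theorem segment_zero (x y : H3) : segment x y 0 = x := by
  refine H3.ext (by simp [vproj_segment]) ?_
  have h := height_segment_sq x y 0
  simp only [Icc.coe_zero, sub_zero, one_mul, zero_mul, add_zero] at h
  exact (pow_left_inj₀ (height_pos _).le (height_pos _).le two_ne_zero).mp h

theorem segment_one (x y : H3) : segment x y 1 = y := by
  refine H3.ext (by simp [vproj_segment]) ?_
  have h := height_segment_sq x y 1
  simp only [Icc.coe_one, sub_self, one_mul, zero_mul, mul_zero, add_zero, zero_add] at h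
  exact (pow_left_inj₀ (height_pos _).le (height_pos _).le two_ne_zero).mp h

/-- The geodesic segment as a path. -/
noncomputable def segmentPath (x y : H3) : Path x y where
  toFun := segment x y
  continuous_toFun := continuous_segment x y
  source' := segment_zero x y
  target' := segment_one x y

theorem norm_sq_convex_comb (z w : ℂ) (s : ℝ) : ‖((1 - s : ℝ) : ℂ) * z + (s : ℂ) * w‖ ^ 2 =
    (1 - s) * ‖z‖ ^ 2 + s * ‖w‖ ^ 2 - s * (1 - s) * ‖z - w‖ ^ 2 := by
  simp only [← Complex.normSq_eq_norm_sq, Complex.normSq_apply, Complex.add_re, Complex.add_im,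
    Complex.mul_re, Complex.mul_im, Complex.ofReal_re, Complex.ofReal_im, Complex.sub_re,
    Complex.sub_im]
  ring

theorem autFactor_segment (g : SL(2, ℂ)) (x y : H3) (s : I) :
    autFactor g (segment x y s) = (1 - s) * autFactor g x + s * autFactor g y := by
  have h : g 1 0 * (((1 - s : ℝ) : ℂ) * vproj x + ((s : ℝ) : ℂ) * vproj y) + g 1 1 =
      ((1 - s : ℝ) : ℂ) * (g 1 0 * vproj x + g 1 1) +
        ((s : ℝ) : ℂ) * (g 1 0 * vproj y + g 1 1) := by
    push_cast
    ring
  rw [autFactor, height_segment_sq, vproj_segment, h, norm_sq_convex_comb, autFactor, autFactor,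
    show g 1 0 * vproj x + g 1 1 - (g 1 0 * vproj y + g 1 1) = g 1 0 * (vproj x - vproj y) by ring,
    norm_mul]
  ring

/-- The minimum of affine functions is reached inside a segment by the same functions as at both
ends, if these reach it by the same ones. -/
theorem nearestEnds_segment (hd : DiscreteTopology Γ)
    (hcusp : IsParabolicPoint Γ OnePoint.infty) (htrans : StabilizerIsTranslations Γ) {x y : H3}
    (h : nearestEnds Γ x = nearestEnds Γ y) (s : I) :
    nearestEnds Γ (segment x y s) = nearestEnds Γ x := by
  have hs0 := s.2.1
  have hs1 : 0 ≤ 1 - (s : ℝ) := sub_nonneg.mpr s.2.2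
  have hboth : ∀ g, IsNearest Γ g x → IsNearest Γ g y := fun g hg =>
    (htrans.mem_nearestEnds_iff hg.mem).mp
      (h ▸ (htrans.mem_nearestEnds_iff hg.mem).mpr hg)
  ext p
  rw [mem_nearestEnds_iff]
  constructor
  · rintro ⟨g, hg, rfl⟩
    obtain ⟨g₀, h₀⟩ := exists_isNearest hd hcusp x
    have h₀' := hboth g₀ h₀
    have h1 := hg.le g₀ h₀.mem
    rw [autFactor_segment, autFactor_segment] at h1
    have hx := h₀.le g hg.mem
    have hy := h₀'.le g hg.mem
    rcases hs1.lt_or_eq with hs | hs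
    · have : autFactor g x ≤ autFactor g₀ x := by nlinarith
      exact mem_nearestEnds_iff.mpr ⟨g, ⟨hg.mem, fun k hk => this.trans (h₀.le k hk)⟩, rfl⟩
    · have : autFactor g y ≤ autFactor g₀ y := by nlinarith
      rw [h]
      exact mem_nearestEnds_iff.mpr ⟨g, ⟨hg.mem, fun k hk => this.trans (h₀'.le k hk)⟩, rfl⟩
  · intro hp
    obtain ⟨g, hg, rfl⟩ := mem_nearestEnds_iff.mp hp
    refine ⟨g, ⟨hg.mem, fun k hk => ?_⟩, rfl⟩
    rw [autFactor_segment, autFactor_segment]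
    exact add_le_add (mul_le_mul_of_nonneg_left (hg.le k hk) hs1)
      (mul_le_mul_of_nonneg_left ((hboth g hg).le k hk) hs0)

theorem joinedIn_of_nearestEnds_eq (hd : DiscreteTopology Γ)
    (hcusp : IsParabolicPoint Γ OnePoint.infty) (htrans : StabilizerIsTranslations Γ) {x y : H3}
    (h : nearestEnds Γ x = nearestEnds Γ y) :
    JoinedIn {z | nearestEnds Γ z = nearestEnds Γ x} x y :=
  ⟨segmentPath x y, nearestEnds_segment hd hcusp htrans h⟩

/-- A cell is the set of all points with a given pair of nearest ends. -/
theorem cell_eq (hd : DiscreteTopology Γ)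
    (hcusp : IsParabolicPoint Γ OnePoint.infty) (htrans : StabilizerIsTranslations Γ) {x : H3}
    (hx : x ∈ regCutLocus Γ) : cell Γ x = {y | nearestEnds Γ y = nearestEnds Γ x} := by
  apply Subset.antisymm
  · intro y hy
    refine nearestEnds_eq_of_isPreconnected hd hcusp
      (isPreconnected_connectedComponentIn (F := regCutLocus Γ) (x := x)) 2
      (fun z hz => connectedComponentIn_subset (regCutLocus Γ) x hz) hy
      (mem_connectedComponentIn hx)
  · have hpc : IsPathConnected {y | nearestEnds Γ y = nearestEnds Γ x} :=
      ⟨x, rfl, fun {y} (hy : nearestEnds Γ y = nearestEnds Γ x) =>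
        joinedIn_of_nearestEnds_eq hd hcusp htrans hy.symm⟩
    refine hpc.isConnected.isPreconnected.subset_connectedComponentIn rfl fun y hy => ?_
    have hy' : nearestEnds Γ y = nearestEnds Γ x := hy
    rw [regCutLocus, mem_ofPred_eq, hy']
    exact hx

/-! ### Summits of cells -/

/-- The Busemann function of the cusp is the logarithm of the largest height in the orbit. -/
theorem busemann_eq {g : SL(2, ℂ)} {x : H3} (hg : IsNearest Γ g x) :
    busemann Γ x = Real.log (height (act g x)) := by
  apply Tendsto.limUnder_eq
  set Y := act g x with hY
  have hYp := height_pos Y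
  set v : ℝ → H3 := fun t => ⟨(0, Real.exp t), Real.exp_pos t⟩ with hv
  have hlog : ∀ t, Real.log (height (v t)) = t := fun t => Real.log_exp t
  have hup : ∀ t, t - orbDist Γ x (v t) ≤ Real.log (height Y) := by
    intro t
    rw [sub_le_comm]
    refine le_orbDist fun k hk => ?_
    rw [← hdist_act k⁻¹, act_inv_act]
    have h1 := abs_log_height_le_hdist (act k⁻¹ x) (v t)
    have h2 := Real.log_le_log (height_pos _) (hg.height_le (Γ.inv_mem hk))
    rw [hlog] at h1
    linarith [(abs_le.mp h1).1]
  have hlow : ∀ t, t - hdist Y (v t) ≤ t - orbDist Γ x (v t) := by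
    intro t
    have h1 := orbDist_le Γ x (v t) (Γ.inv_mem hg.mem)
    rw [← hdist_act g, act_act_inv] at h1
    linarith
  refine tendsto_of_tendsto_of_tendsto_of_le_of_le ?_ tendsto_const_nhds hlow hup
  -- `exp (hdist Y (v t))` is at most twice its hyperbolic cosine, hence close to `exp t / height Y`
  have hneg : Tendsto (fun t : ℝ => Real.exp (-(2 * t))) atTop (𝓝 0) :=
    Real.tendsto_exp_neg_atTop_nhds_zero.comp (tendsto_id.const_mul_atTop two_pos)
  have hlim : Tendsto (fun t => -Real.log (1 / height Y + (‖vproj Y‖ ^ 2 + height Y ^ 2) /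
      height Y * Real.exp (-(2 * t)))) atTop (𝓝 (Real.log (height Y))) := by
    have h1 := (hneg.const_mul ((‖vproj Y‖ ^ 2 + height Y ^ 2) / height Y)).const_add
      (1 / height Y)
    rw [mul_zero, add_zero] at h1
    have h2 := (h1.log (by positivity)).neg
    rwa [show -Real.log (1 / height Y) = Real.log (height Y) by
      rw [one_div, Real.log_inv, neg_neg]] at h2
  refine tendsto_of_tendsto_of_tendsto_of_le_of_le hlim tendsto_const_nhds (fun t => ?_)
    fun t => (hlow t).trans (hup t)
  have h1 : Real.exp (hdist Y (v t)) ≤ 2 * Real.cosh (hdist Y (v t)) := by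
    rw [Real.cosh_eq]
    linarith [Real.exp_pos (-hdist Y (v t))]
  have h2 : 2 * Real.cosh (hdist Y (v t)) = Real.exp t *
      (1 / height Y + (‖vproj Y‖ ^ 2 + height Y ^ 2) / height Y * Real.exp (-(2 * t))) := by
    rw [cosh_hdist, show vproj (v t) = 0 from rfl, show height (v t) = Real.exp t from rfl,
      sub_zero,
      show Real.exp (-(2 * t)) = (Real.exp t)⁻¹ * (Real.exp t)⁻¹ by
        rw [← Real.exp_neg, ← Real.exp_add]; ring_nf]
    have := Real.exp_pos t
    field_simp
    ring
  rw [h2] at h1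
  have h3 := Real.log_le_log (Real.exp_pos _) h1
  rw [Real.log_exp, Real.log_mul (Real.exp_pos t).ne' (by positivity), Real.log_exp] at h3
  change _ ≤ t - hdist Y (v t)
  linarith

theorem bact_inv_infty (k : SL(2, ℂ)) (hc : k 1 0 ≠ 0) :
    bact k⁻¹ OnePoint.infty = ((-(k 1 1 / k 1 0) : ℂ) : OnePoint ℂ) := by
  obtain ⟨e00, -, e10, -⟩ := inv_entries k
  rw [bact_infty, e10, e00, if_neg (neg_ne_zero.mpr hc), div_neg]

theorem autFactor_eq_of_ne_zero (k : SL(2, ℂ)) (hc : k 1 0 ≠ 0) (x : H3) : autFactor k x =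
    ‖k 1 0‖ ^ 2 * (‖vproj x - -(k 1 1 / k 1 0)‖ ^ 2 + height x ^ 2) := by
  have : k 1 0 * vproj x + k 1 1 = k 1 0 * (vproj x - -(k 1 1 / k 1 0)) := by
    field_simp
    ring
  rw [autFactor, this, norm_mul]
  ring

/-- The summit of the cell between the basins of `g⁻¹ ∞` and `g'⁻¹ ∞` lies on the geodesic line that
joins these points.  Once `g` has moved the first point to `∞`, the cell is open in a hemisphere
centred at the second one, and the Busemann function increases with the height along it: a point
that does not lie above the centre can be raised inside the cell. -/
theorem IsSummit.bact_eq_vproj (hd : DiscreteTopology Γ)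
    (hcusp : IsParabolicPoint Γ OnePoint.infty) (htrans : StabilizerIsTranslations Γ)
    {g g' : SL(2, ℂ)} (hg : g ∈ Γ) (hg' : g' ∈ Γ) {x y : H3}
    (hne : bact g⁻¹ OnePoint.infty ≠ bact g'⁻¹ OnePoint.infty)
    (hx : nearestEnds Γ x = {bact g⁻¹ OnePoint.infty, bact g'⁻¹ OnePoint.infty})
    (hy : IsSummit Γ (cell Γ x) y) :
    bact g (bact g'⁻¹ OnePoint.infty) = (vproj (act g y) : OnePoint ℂ) := by
  have hreg : x ∈ regCutLocus Γ := by
    rw [regCutLocus, mem_ofPred_eq, hx, encard_pair hne]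
  obtain ⟨hyc, hmax⟩ := hy
  rw [cell_eq hd hcusp htrans hreg] at hyc hmax
  have hEy : nearestEnds Γ y = nearestEnds Γ x := hyc
  have hgy : IsNearest Γ g y := (htrans.mem_nearestEnds_iff hg).mp (by rw [hEy, hx]; simp)
  have hg'y : IsNearest Γ g' y := (htrans.mem_nearestEnds_iff hg').mp (by rw [hEy, hx]; simp)
  set k := g' * g⁻¹ with hk
  have hmul : ∀ z, autFactor g' z = autFactor k (act g z) * autFactor g z := fun z => by
    rw [← autFactor_mul, hk, inv_mul_cancel_right]
  have hc : k 1 0 ≠ 0 := by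
    rw [Ne, lower_left_eq_zero_iff, hk, bact_mul]
    intro h
    apply hne
    rw [← h, bact_inv_bact, h]
  have hw : bact g (bact g'⁻¹ OnePoint.infty) = ((-(k 1 1 / k 1 0) : ℂ) : OnePoint ℂ) := by
    rw [← bact_inv_infty k hc, ← bact_mul, hk, _root_.mul_inv_rev, inv_inv]
  rw [hw, OnePoint.coe_eq_coe]
  set w := -(k 1 1 / k 1 0) with hwdef
  set Z := vproj (act g y) with hZ
  set H := height (act g y) with hH
  have hHp : 0 < H := height_pos _
  by_contra hZw
  have hR : 0 < ‖Z - w‖ := norm_pos_iff.mpr (sub_ne_zero.mpr (Ne.symm hZw))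
  -- a curve on the hemisphere, from `act g y` at `s = 0` to the top at `s = 1`; the maximum only
  -- serves to define it for all real `s`
  set Y : ℝ → H3 := fun s => ⟨(Z + s * (w - Z), √(H ^ 2 + ‖Z - w‖ ^ 2 * max (2 * s - s ^ 2) 0)),
    Real.sqrt_pos.mpr (by positivity)⟩ with hY
  have hYc : Continuous Y := by
    refine Continuous.subtype_mk (Continuous.prodMk ?_ ?_) _ <;> fun_prop
  have hY0 : Y 0 = act g y := by
    have h1 : vproj (Y 0) = Z + ((0 : ℝ) : ℂ) * (w - Z) := rfl
    have h2 : height (Y 0) = √(H ^ 2 + ‖Z - w‖ ^ 2 * max (2 * 0 - 0 ^ 2) 0) := rfl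
    refine H3.ext (by rw [h1, Complex.ofReal_zero, zero_mul, add_zero]) ?_
    rw [h2, mul_zero, zero_pow two_ne_zero, sub_zero, max_self, mul_zero, add_zero,
      Real.sqrt_sq hHp.le]
  have hcurve : Tendsto (fun s => act g⁻¹ (Y s)) (𝓝[>] 0) (𝓝 y) := by
    have h := ((continuous_act g⁻¹).comp hYc).tendsto 0
    simp only [Function.comp_apply, hY0, act_inv_act] at h
    exact h.mono_left nhdsWithin_le_nhds
  have h1 := hcurve.eventually (eventually_nearestEnds_subset hd hcusp y)
  have h2 := hcurve.eventually (eventually_nhdsWithin_iff.mp hmax)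
  have h3 : ∀ᶠ s : ℝ in 𝓝[>] 0, s < 1 :=
    (eventually_lt_nhds one_pos).filter_mono nhdsWithin_le_nhds
  -- for small `s > 0` the curve is still in the cell, and strictly higher than `act g y`
  obtain ⟨s, ⟨h1, h2⟩, h3, hs0⟩ := ((h1.and h2).and (h3.and self_mem_nhdsWithin)).exists
  have hs0 : 0 < s := hs0
  have hpos : 0 < 2 * s - s ^ 2 := by nlinarith
  have hheight : height (Y s) ^ 2 = H ^ 2 + ‖Z - w‖ ^ 2 * (2 * s - s ^ 2) := by
    rw [← max_eq_left hpos.le]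
    exact Real.sq_sqrt (by positivity)
  have hk1 : autFactor k (Y s) = 1 := by
    have e1 : autFactor k (act g y) = 1 := by
      have e := hmul y
      rw [le_antisymm (hg'y.le g hg) (hgy.le g' hg')] at e
      exact (mul_eq_right₀ (autFactor_pos g y).ne').mp e.symm
    have e2 : vproj (Y s) - w = ((1 - s : ℝ) : ℂ) * (Z - w) := by
      have : vproj (Y s) = Z + s * (w - Z) := rfl
      rw [this]
      push_cast
      ring
    rw [autFactor_eq_of_ne_zero k hc, ← hwdef] at e1 ⊢
    rw [← hZ, ← hH] at e1
    rw [e2, hheight, norm_mul, Complex.norm_of_nonneg (by linarith)]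
    linear_combination e1
  have heq : autFactor g' (act g⁻¹ (Y s)) = autFactor g (act g⁻¹ (Y s)) := by
    rw [hmul, act_act_inv, hk1, one_mul]
  have hEs : IsNearest Γ g (act g⁻¹ (Y s)) := by
    obtain ⟨g₁, hg₁⟩ := exists_isNearest hd hcusp (act g⁻¹ (Y s))
    have hmem := h1 (mem_nearestEnds_iff.mpr ⟨g₁, hg₁, rfl⟩)
    rw [hEy, hx] at hmem
    refine ⟨hg, fun m hm => le_trans (le_of_eq ?_) (hg₁.le m hm)⟩
    rcases hmem with h | h
    · exact htrans.autFactor_congr hg hg₁.mem h.symm _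
    · rw [← heq]
      exact htrans.autFactor_congr hg' hg₁.mem (Eq.symm h) _
  have hEs' : IsNearest Γ g' (act g⁻¹ (Y s)) := ⟨hg', fun m hm => heq.trans_le (hEs.le m hm)⟩
  have hle := h2 (by
    change nearestEnds Γ (act g⁻¹ (Y s)) = nearestEnds Γ x
    refine Subset.antisymm (hEy ▸ h1) ?_
    rw [hx]
    rintro p (rfl | rfl)
    · exact (htrans.mem_nearestEnds_iff hg).mpr hEs
    · exact (htrans.mem_nearestEnds_iff hg').mpr hEs')
  rw [busemann_eq hEs, busemann_eq hgy, act_act_inv,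
    Real.log_le_log_iff (height_pos _) (height_pos _)] at hle
  have : height (Y s) ^ 2 ≤ H ^ 2 := by
    have := height_pos (Y s)
    gcongr
  nlinarith [mul_pos (pow_pos hR 2) hpos]

/-! ### Displacements of paths in the cusp section -/

theorem discreteTopology_translations (hd : DiscreteTopology Γ) :
    DiscreteTopology (translations Γ) := by
  have hfin : {b : translations Γ | ‖(b : ℂ)‖ < 1}.Finite := by
    refine Finite.of_finite_image ?_ Subtype.val_injective.injOn
    refine ((finite_bounded_entries hd 1).image fun g => g 0 1 / g 1 1).subset ?_
    rintro _ ⟨⟨b, g, hg, h⟩, hb, rfl⟩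
    have hb : ‖b‖ < 1 := hb
    obtain ⟨hc, ha, hb', hd'⟩ := entries_of_bact_eq_add h
    have hd1 : ‖g 1 1‖ = 1 := by
      have : ‖g 1 1‖ ^ 2 = 1 := by rw [← norm_pow, hd', norm_one]
      exact (pow_eq_one_iff_of_nonneg (norm_nonneg _) two_ne_zero).mp this
    have hd0 : g 1 1 ≠ 0 := by
      rw [← norm_pos_iff, hd1]
      exact one_pos
    refine ⟨g, ⟨hg, fun i j => ?_⟩, by simp only [hb']; field_simp⟩
    fin_cases i <;> fin_cases j <;> simp only [Fin.zero_eta, Fin.mk_one]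
    · rw [ha, hd1]
    · rw [hb', norm_mul, hd1, mul_one]; exact hb.le
    · rw [hc, norm_zero]; exact zero_le_one
    · rw [hd1]
  apply discreteTopology_of_isOpen_singleton_zero
  refine isOpen_singleton_of_finite_mem_nhds 0 ?_ hfin
  have hopen : IsOpen {b : translations Γ | ‖(b : ℂ)‖ < 1} :=
    isOpen_lt continuous_subtype_val.norm continuous_const
  exact hopen.mem_nhds (by simp)

theorem isCoveringMap_cuspSection (hd : DiscreteTopology Γ) :
    IsCoveringMap (QuotientAddGroup.mk : ℂ → CuspSection Γ) := by
  have := discreteTopology_translations hd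
  exact ((translations Γ).isAddQuotientCoveringMap_of_comm
    (isDiscrete_iff_discreteTopology.mpr this)).isCoveringMap

/-- The displacement of the class of a path of `ℂ / translations Γ` is the difference of the
endpoints of any lift, by the monodromy theorem. -/
theorem HasDisplacement.eq (hd : DiscreteTopology Γ) {x y : ℂ} {c : Path x y} {w : ℂ}
    (h : HasDisplacement Γ (Path.Homotopic.Quotient.mk
      (c.map (f := (QuotientAddGroup.mk : ℂ → CuspSection Γ)) continuous_quot_mk)) w) :
    w = y - x := by
  obtain ⟨x', y', c', hx, hy, hA, rfl⟩ := h
  have hτ : x - x' ∈ translations Γ := by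
    rw [← QuotientAddGroup.eq_iff_sub_mem]
    exact hx
  obtain ⟨F⟩ := Path.Homotopic.Quotient.exact hA
  set c'' : C(I, ℂ) := ⟨fun s => c' s + (x - x'), by fun_prop⟩ with hc''
  have hrel : c.toContinuousMap.HomotopicRel c'' {0, 1} := by
    refine ((isCoveringMap_cuspSection hd).homotopicRel_iff_comp (f₀ := c.toContinuousMap)
      (f₁ := c'') (S := {0, 1}) ⟨0, by simp, ?_⟩).mpr ?_
    · simp [hc'']
    · have hcomp : ContinuousMap.comp ⟨_, (isCoveringMap_cuspSection hd).continuous⟩ c'' =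
          ((c'.map (f := (QuotientAddGroup.mk : ℂ → CuspSection Γ)) continuous_quot_mk).cast
            hx hy).toContinuousMap := by
        ext s
        refine (QuotientAddGroup.eq_iff_sub_mem (N := translations Γ)).mpr ?_
        simpa [hc''] using hτ
      rw [hcomp]
      exact ⟨F⟩
  obtain ⟨G⟩ := hrel
  have h1 : c 1 = c' 1 + (x - x') := G.fst_eq_snd (x := 1) (by simp)
  rw [c.target, c'.target] at h1
  rw [h1]
  ring

theorem hasDisplacement_map {x y : ℂ} (c : Path x y) :
    HasDisplacement Γ (Path.Homotopic.Quotient.mk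
      (c.map (f := (QuotientAddGroup.mk : ℂ → CuspSection Γ)) continuous_quot_mk)) (y - x) :=
  ⟨x, y, c, rfl, rfl, rfl, rfl⟩

/-- The lift to `ℂ` of the image of a path under the retraction towards `g ∞`. -/
noncomputable def liftRetraction (g : SL(2, ℂ)) {x y : H3} (c : Path x y) :
    Path (vproj (act g⁻¹ x)) (vproj (act g⁻¹ y)) :=
  c.map (continuous_vproj.comp (continuous_act g⁻¹))

theorem hasDisplacement_retraction_iff (hd : DiscreteTopology Γ) (g : SL(2, ℂ)) {x y : H3}
    (c : Path x y) (w : ℂ) :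
    HasDisplacement Γ (Path.Homotopic.Quotient.mk (c.map (retraction Γ g).continuous)) w ↔
      w = vproj (act g⁻¹ y) - vproj (act g⁻¹ x) := by
  constructor
  · exact fun h => HasDisplacement.eq hd (c := liftRetraction g c) h
  · rintro rfl
    exact hasDisplacement_map (liftRetraction g c)

/-! ### Crossings of the cut locus by a vertical line -/

theorem continuous_line (ξ : ℂ) : Continuous (line ξ) := by
  unfold line
  refine Continuous.subtype_mk (Continuous.prodMk ?_ ?_) _ <;> fun_prop

theorem autFactor_line (g : SL(2, ℂ)) (ξ : ℂ) (t : ℝ) : autFactor g (line ξ t) =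
    ‖g 1 0 * ξ + g 1 1‖ ^ 2 + ‖g 1 0‖ ^ 2 * Real.exp (-t) ^ 2 := rfl

theorem encard_nearestEnds_eq_one (hd : DiscreteTopology Γ)
    (hcusp : IsParabolicPoint Γ OnePoint.infty) {x : H3} (hx : x ∉ cutLocus Γ) :
    (nearestEnds Γ x).encard = 1 := by
  have h1 : 1 ≤ (nearestEnds Γ x).encard :=
    one_le_encard_iff_nonempty.mpr (nearestEnds_nonempty hd hcusp x)
  have h2 : (nearestEnds Γ x).encard < 2 := not_le.mp hx
  exact le_antisymm (Order.le_of_lt_add_one (by rwa [one_add_one_eq_two])) h1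

theorem notMem_cutLocus_of_eq_singleton {x : H3} {p : OnePoint ℂ} (h : nearestEnds Γ x = {p}) :
    x ∉ cutLocus Γ := by
  rw [cutLocus, mem_ofPred_eq, h, encard_singleton]
  simp

/-- High up on a vertical line, only `∞` is nearest. -/
theorem eventually_nearestEnds_line_atBot (hd : DiscreteTopology Γ)
    (hcusp : IsParabolicPoint Γ OnePoint.infty) (ξ : ℂ) :
    ∀ᶠ t in atBot, nearestEnds Γ (line ξ t) = {OnePoint.infty} := by
  have hfin := finite_rows_of_autFactor_le hd hcusp ‖ξ‖ one_pos 1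
  have hexp : Tendsto (fun t : ℝ => Real.exp (-t)) atBot atTop :=
    Real.tendsto_exp_atTop.comp tendsto_neg_atBot_atTop
  have h1 := (Filter.eventually_all_finite (l := atBot)
    (p := fun (r : ℂ × ℂ) (t : ℝ) => r.1 ≠ 0 → 1 < ‖r.1‖ ^ 2 * Real.exp (-t) ^ 2) hfin).mpr
    fun r _ => by
      by_cases hr : r.1 = 0
      · exact Eventually.of_forall fun t h => absurd hr h
      · have : 0 < ‖r.1‖ ^ 2 := by
          have := norm_pos_iff.mpr hr
          positivity
        filter_upwards [(((tendsto_pow_atTop two_ne_zero).comp hexp).const_mul_atTop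
          this).eventually_gt_atTop 1] with t ht _ using ht
  filter_upwards [h1, eventually_le_atBot 0] with t h1 ht
  refine (nearestEnds_nonempty hd hcusp _).subset_singleton_iff.mp fun p hp => ?_
  obtain ⟨g, hg, rfl⟩ := mem_nearestEnds_iff.mp hp
  have hle := hg.le 1 Γ.one_mem
  rw [autFactor_one] at hle
  have hheight : 1 ≤ height (line ξ t) := Real.one_le_exp (by linarith)
  have h2 := h1 _ ⟨g, hg.mem, rfl, line ξ t, le_rfl, hheight, hle⟩
  have hc : g 1 0 = 0 := by
    by_contra hc
    have h3 : 1 < ‖g 1 0‖ ^ 2 * Real.exp (-t) ^ 2 := h2 hc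
    rw [autFactor_line] at hle
    nlinarith [sq_nonneg ‖g 1 0 * ξ + g 1 1‖]
  have h4 := (lower_left_eq_zero_iff g).mp hc
  rw [mem_singleton_iff]
  conv_lhs => rw [← h4]
  exact bact_inv_bact g _

/-- At the parameter `s` the line passes from the basin of `p` to that of `q`, through the regular
part of the cut locus. -/
structure IsCrossing (Γ : Subgroup SL(2, ℂ)) (ξ : ℂ) (s : ℝ) (p q : OnePoint ℂ) : Prop where
  ne : p ≠ q
  nearestEnds_eq : nearestEnds Γ (line ξ s) = {p, q}
  before : ∀ᶠ u in 𝓝[<] s, nearestEnds Γ (line ξ u) = {p}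
  after : ∀ᶠ u in 𝓝[>] s, nearestEnds Γ (line ξ u) = {q}
  ne_infty : q ≠ OnePoint.infty

theorem eq_singleton_of_subset_pair {s : Set (OnePoint ℂ)} {p q : OnePoint ℂ} (hs : s.Nonempty)
    (h : s ⊆ {p, q}) (hq : q ∉ s) : s = {p} := by
  refine hs.subset_singleton_iff.mp fun r hr => ?_
  rcases h hr with rfl | h'
  · rfl
  · exact absurd (h' ▸ hr) hq

/-- As functions of `exp (-t) ^ 2`, the factors of `g` and `g'` are affine with slopes `‖c‖ ^ 2`, so
that the one with the smaller slope wins above their common value, and the other one below. -/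
theorem isCrossing_of_norm_lt (hd : DiscreteTopology Γ)
    (hcusp : IsParabolicPoint Γ OnePoint.infty) (htrans : StabilizerIsTranslations Γ) {ξ : ℂ}
    {s : ℝ} {g g' : SL(2, ℂ)} (hg : g ∈ Γ) (hg' : g' ∈ Γ)
    (hE : nearestEnds Γ (line ξ s) = {bact g⁻¹ OnePoint.infty, bact g'⁻¹ OnePoint.infty})
    (hlt : ‖g 1 0‖ < ‖g' 1 0‖) :
    IsCrossing Γ ξ s (bact g⁻¹ OnePoint.infty) (bact g'⁻¹ OnePoint.infty) := by
  have h1 : IsNearest Γ g (line ξ s) := (htrans.mem_nearestEnds_iff hg).mp (by rw [hE]; simp)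
  have h2 : IsNearest Γ g' (line ξ s) := (htrans.mem_nearestEnds_iff hg').mp (by rw [hE]; simp)
  have heq : autFactor g (line ξ s) = autFactor g' (line ξ s) :=
    le_antisymm (h1.le g' hg') (h2.le g hg)
  have hdiff : ∀ u, autFactor g' (line ξ u) - autFactor g (line ξ u) =
      (‖g' 1 0‖ ^ 2 - ‖g 1 0‖ ^ 2) * (Real.exp (-u) ^ 2 - Real.exp (-s) ^ 2) := fun u => by
    rw [autFactor_line, autFactor_line] at heq ⊢
    linear_combination -heq
  have hB : 0 < ‖g' 1 0‖ ^ 2 - ‖g 1 0‖ ^ 2 := by nlinarith [norm_nonneg (g 1 0)]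
  have hnear : ∀ᶠ u in 𝓝 s, nearestEnds Γ (line ξ u) ⊆
      {bact g⁻¹ OnePoint.infty, bact g'⁻¹ OnePoint.infty} := by
    rw [← hE]
    exact (continuous_line ξ).continuousAt.eventually
      (eventually_nearestEnds_subset hd hcusp (line ξ s))
  refine ⟨?_, hE, ?_, ?_, ?_⟩
  · intro h
    have h3 := htrans.autFactor_congr hg hg' h (line ξ (s - 1))
    have h4 := hdiff (s - 1)
    have h5 : Real.exp (-s) < Real.exp (-(s - 1)) := Real.exp_lt_exp.mpr (by linarith)
    have h6 := Real.exp_pos (-s)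
    have : 0 < Real.exp (-(s - 1)) ^ 2 - Real.exp (-s) ^ 2 := by nlinarith
    have := mul_pos hB this
    linarith
  · filter_upwards [hnear.filter_mono nhdsWithin_le_nhds, self_mem_nhdsWithin] with u hu hus
    have hus : u < s := hus
    refine eq_singleton_of_subset_pair (nearestEnds_nonempty hd hcusp _) hu fun h => ?_
    have h3 := ((htrans.mem_nearestEnds_iff hg').mp h).le g hg
    have h5 : Real.exp (-s) < Real.exp (-u) := Real.exp_lt_exp.mpr (by linarith)
    have h6 := Real.exp_pos (-s)
    have : 0 < Real.exp (-u) ^ 2 - Real.exp (-s) ^ 2 := by nlinarith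
    have := mul_pos hB this
    linarith [hdiff u]
  · filter_upwards [hnear.filter_mono nhdsWithin_le_nhds, self_mem_nhdsWithin] with u hu hus
    have hus : s < u := hus
    rw [pair_comm] at hu
    refine eq_singleton_of_subset_pair (nearestEnds_nonempty hd hcusp _) hu fun h => ?_
    have h3 := ((htrans.mem_nearestEnds_iff hg).mp h).le g' hg'
    have h5 : Real.exp (-u) < Real.exp (-s) := Real.exp_lt_exp.mpr (by linarith)
    have h6 := Real.exp_pos (-u)
    have : 0 < Real.exp (-s) ^ 2 - Real.exp (-u) ^ 2 := by nlinarith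
    have := mul_pos hB this
    linarith [hdiff u]
  · rw [Ne, ← lower_left_eq_zero_iff, (inv_entries g').2.2.1, neg_eq_zero]
    intro h
    rw [h, norm_zero] at hlt
    exact absurd hlt (not_lt.mpr (norm_nonneg _))

/-- The line is transverse to the cells it meets.  Otherwise the two nearest ends of some point
would be equally near all along the line; as the line avoids the singular part of the cut locus,
the set of parameters where they are nearest would be open and closed, although only `∞` is
nearest high up on the line. -/
theorem IsTotallyIrrational.exists_isCrossing (hd : DiscreteTopology Γ)
    (hcusp : IsParabolicPoint Γ OnePoint.infty) (htrans : StabilizerIsTranslations Γ) {ξ : ℂ}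
    (hξ : IsTotallyIrrational Γ ξ) {s : ℝ} (hs : line ξ s ∈ cutLocus Γ) :
    ∃ p q, IsCrossing Γ ξ s p q := by
  obtain ⟨p, q, hpq, hE⟩ := encard_eq_two.mp (hξ.2 s hs)
  obtain ⟨g, hgs, rfl⟩ := mem_nearestEnds_iff.mp (show p ∈ nearestEnds Γ _ by rw [hE]; simp)
  obtain ⟨g', hgs', rfl⟩ := mem_nearestEnds_iff.mp (show q ∈ nearestEnds Γ _ by rw [hE]; simp)
  have hg := hgs.mem
  have hg' := hgs'.mem
  rcases lt_trichotomy ‖g 1 0‖ ‖g' 1 0‖ with hlt | heq | hgt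
  · exact ⟨_, _, isCrossing_of_norm_lt hd hcusp htrans hg hg' hE hlt⟩
  · exfalso
    have hsame : ∀ u, autFactor g (line ξ u) = autFactor g' (line ξ u) := fun u => by
      have h := le_antisymm (hgs.le g' hg') (hgs'.le g hg)
      rw [autFactor_line, autFactor_line, heq] at h ⊢
      linarith
    have hboth : ∀ u, IsNearest Γ g' (line ξ u) ↔ IsNearest Γ g (line ξ u) := fun u =>
      ⟨fun h => ⟨hg, fun k hk => (hsame u).trans_le (h.le k hk)⟩,
        fun h => ⟨hg', fun k hk => (hsame u).symm.trans_le (h.le k hk)⟩⟩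
    have hclosed : IsClosed {u | IsNearest Γ g (line ξ u)} := by
      have : {u | IsNearest Γ g (line ξ u)} =
          ⋂ k ∈ Γ, {u | autFactor g (line ξ u) ≤ autFactor k (line ξ u)} := by
        ext u
        simp only [mem_iInter]
        exact ⟨fun h => h.le, fun h => ⟨hg, h⟩⟩
      rw [this]
      exact isClosed_biInter fun k _ => isClosed_le
        ((continuous_autFactor g).comp (continuous_line ξ))
        ((continuous_autFactor k).comp (continuous_line ξ))
    have hopen : IsOpen {u | IsNearest Γ g (line ξ u)} := by
      rw [isOpen_iff_mem_nhds]
      intro u hu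
      have hu : IsNearest Γ g (line ξ u) := hu
      have hsub : {bact g⁻¹ OnePoint.infty, bact g'⁻¹ OnePoint.infty} ⊆
          nearestEnds Γ (line ξ u) := by
        rintro _ (rfl | rfl)
        · exact (htrans.mem_nearestEnds_iff hg).mpr hu
        · exact (htrans.mem_nearestEnds_iff hg').mpr ((hboth u).mpr hu)
      have h2 : (nearestEnds Γ (line ξ u)).encard = 2 := by
        refine hξ.2 u ?_
        have := encard_le_encard hsub
        rwa [encard_pair hpq] at this
      have heq2 := (Set.finite_of_encard_eq_coe (k := 2) (encard_pair hpq)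
        ).eq_of_subset_of_encard_le hsub (by rw [h2, encard_pair hpq])
      filter_upwards [(continuous_line ξ).continuousAt.eventually
        (eventually_nearestEnds_subset hd hcusp (line ξ u))] with v hv
      obtain ⟨r, hr⟩ := nearestEnds_nonempty hd hcusp (line ξ v)
      have hr' := hv hr
      rw [← heq2] at hr'
      rcases hr' with rfl | rfl
      · exact (htrans.mem_nearestEnds_iff hg).mp hr
      · exact (hboth v).mp ((htrans.mem_nearestEnds_iff hg').mp hr)
    have huniv := IsClopen.eq_univ ⟨hclosed, hopen⟩ ⟨s, hgs⟩
    obtain ⟨u, hu⟩ := (eventually_nearestEnds_line_atBot hd hcusp ξ).exists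
    have hgu : u ∈ {u | IsNearest Γ g (line ξ u)} := by rw [huniv]; exact mem_univ u
    have hgu : IsNearest Γ g (line ξ u) := hgu
    have h1 := (htrans.mem_nearestEnds_iff hg).mpr hgu
    have h2 := (htrans.mem_nearestEnds_iff hg').mpr ((hboth u).mpr hgu)
    rw [hu] at h1 h2
    exact hpq (h1.trans h2.symm)
  · rw [pair_comm] at hE
    exact ⟨_, _, isCrossing_of_norm_lt hd hcusp htrans hg' hg hE hgt⟩

theorem IsTotallyIrrational.eventually_notMem_cutLocus (hd : DiscreteTopology Γ)
    (hcusp : IsParabolicPoint Γ OnePoint.infty) (htrans : StabilizerIsTranslations Γ) {ξ : ℂ}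
    (hξ : IsTotallyIrrational Γ ξ) (s : ℝ) : ∀ᶠ u in 𝓝[≠] s, line ξ u ∉ cutLocus Γ := by
  by_cases hs : line ξ s ∈ cutLocus Γ
  · obtain ⟨p, q, h⟩ := hξ.exists_isCrossing hd hcusp htrans hs
    rw [← Iio_union_Ioi, nhdsWithin_union, eventually_sup]
    exact ⟨h.before.mono fun u hu => notMem_cutLocus_of_eq_singleton hu,
      h.after.mono fun u hu => notMem_cutLocus_of_eq_singleton hu⟩
  · have h1 := encard_nearestEnds_eq_one hd hcusp hs
    refine Eventually.filter_mono nhdsWithin_le_nhds ?_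
    filter_upwards [(continuous_line ξ).continuousAt.eventually
      (eventually_nearestEnds_subset hd hcusp (line ξ s))] with u hu h2
    have h3 : (2 : ℕ∞) ≤ 1 := (le_trans h2 (encard_le_encard hu)).trans_eq h1
    simp at h3

theorem IsTotallyIrrational.finite_cut_inter_Icc (hd : DiscreteTopology Γ)
    (hcusp : IsParabolicPoint Γ OnePoint.infty) (htrans : StabilizerIsTranslations Γ) {ξ : ℂ}
    (hξ : IsTotallyIrrational Γ ξ) (a b : ℝ) :
    ({s | line ξ s ∈ cutLocus Γ} ∩ Icc a b).Finite := by
  by_contra hinf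
  obtain ⟨s, -, hs⟩ := Set.Infinite.exists_accPt_of_subset_isCompact hinf isCompact_Icc
    inter_subset_right
  rw [accPt_iff_frequently_nhdsNE] at hs
  exact hs ((hξ.eventually_notMem_cutLocus hd hcusp htrans s).mono fun u hu h => hu h.1)

theorem nearestEnds_line_eq (hd : DiscreteTopology Γ)
    (hcusp : IsParabolicPoint Γ OnePoint.infty) {ξ : ℂ} {J : Set ℝ} (hJ : IsPreconnected J)
    (hcut : ∀ u ∈ J, line ξ u ∉ cutLocus Γ) {u v : ℝ} (hu : u ∈ J) (hv : v ∈ J) :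
    nearestEnds Γ (line ξ u) = nearestEnds Γ (line ξ v) := by
  refine nearestEnds_eq_of_isPreconnected hd hcusp
    (hJ.image _ (continuous_line ξ).continuousOn) 1 ?_ (mem_image_of_mem _ hu)
    (mem_image_of_mem _ hv)
  rintro _ ⟨w, hw, rfl⟩
  exact encard_nearestEnds_eq_one hd hcusp (hcut w hw)

/-- The orbits of the points of a compact set have bounded heights: height varies with distance, and
the orbit of one point has a highest point. -/
theorem exists_height_le_of_isCompact (hd : DiscreteTopology Γ)
    (hcusp : IsParabolicPoint Γ OnePoint.infty) {K : Set H3} (hK : IsCompact K) :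
    ∃ Δ, ∀ x ∈ K, ∀ k ∈ Γ, height (act k x) ≤ Δ := by
  rcases K.eq_empty_or_nonempty with rfl | ⟨x₀, hx₀⟩
  · exact ⟨0, fun x hx => absurd hx (notMem_empty x)⟩
  obtain ⟨x₁, -, hmax⟩ := hK.exists_isMaxOn ⟨x₀, hx₀⟩ (continuous_hdist_left x₀).continuousOn
  obtain ⟨g, hg⟩ := exists_isNearest hd hcusp x₀
  refine ⟨Real.exp (Real.log (height (act g x₀)) + hdist x₁ x₀), fun x hx k hk => ?_⟩
  rw [← Real.log_le_iff_le_exp (height_pos _)]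
  have h1 := abs_log_height_le_hdist (act k x) (act k x₀)
  have h2 := Real.log_le_log (height_pos _) (hg.height_le hk)
  have h3 : hdist x x₀ ≤ hdist x₁ x₀ := hmax hx
  rw [hdist_act] at h1
  linarith [(abs_le.mp h1).2]

/-- A recurrent line does not stay in a single basin: the height in this basin of a point of the
line tends to `0`, or to `∞` if the line ends at the point at infinity of the basin. -/
theorem IsRecurrent.exists_mem_cutLocus (hd : DiscreteTopology Γ)
    (hcusp : IsParabolicPoint Γ OnePoint.infty) (htrans : StabilizerIsTranslations Γ) {ξ : ℂ}
    (hξ : IsRecurrent Γ (line ξ)) (T : ℝ) : ∃ s, T < s ∧ line ξ s ∈ cutLocus Γ := by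
  by_contra! hcut
  obtain ⟨K, hK, hfreq⟩ := hξ
  obtain ⟨g, hg⟩ := exists_isNearest hd hcusp (line ξ (T + 1))
  have hnear : ∀ u, T < u → IsNearest Γ g (line ξ u) := fun u hu => by
    rw [← htrans.mem_nearestEnds_iff hg.mem, nearestEnds_line_eq hd hcusp
      isPreconnected_Ioi (fun u hu => hcut u hu) (mem_Ioi.mpr hu) (mem_Ioi.mpr (lt_add_one T)),
      htrans.mem_nearestEnds_iff hg.mem]
    exact hg
  obtain ⟨t₀, k₀, -, hk₀⟩ := hfreq.exists
  obtain ⟨x₁, -, hmin⟩ := hK.exists_isMinOn ⟨_, hk₀⟩ continuous_height.continuousOn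
  obtain ⟨Δ, hΔ⟩ := exists_height_le_of_isCompact hd hcusp hK
  have hδ := height_pos x₁
  have hbounds : ∃ᶠ t in atTop, height x₁ ≤ height (act g (line ξ t)) ∧
      height (act g (line ξ t)) ≤ Δ := by
    refine (hfreq.and_eventually (eventually_gt_atTop T)).mono ?_
    rintro t ⟨⟨k, hk, hkt⟩, hT⟩
    constructor
    · have h1 : height x₁ ≤ height (act k (line ξ t)) := hmin hkt
      exact h1.trans ((hnear t hT).height_le hk)
    · have := hΔ _ hkt (g * k⁻¹) (Γ.mul_mem hg.mem (Γ.inv_mem hk))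
      rwa [← act_mul, inv_mul_cancel_right] at this
  have hheight : ∀ t, height (act g (line ξ t)) = Real.exp (-t) /
      (‖g 1 0 * ξ + g 1 1‖ ^ 2 + ‖g 1 0‖ ^ 2 * Real.exp (-t) ^ 2) := fun t => rfl
  -- the first case is the one where `ξ = g⁻¹ ∞`
  rcases (norm_nonneg (g 1 0 * ξ + g 1 1)).eq_or_lt with h0 | hpos
  · have hB : 0 < ‖g 1 0‖ ^ 2 := by
      have := autFactor_pos g (line ξ 0)
      rw [autFactor_line, ← h0] at this
      simpa using this
    have hlim : Tendsto (fun t => Real.exp t / ‖g 1 0‖ ^ 2) atTop atTop :=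
      Real.tendsto_exp_atTop.atTop_div_const hB
    obtain ⟨t, ⟨-, h1⟩, h2⟩ := (hbounds.and_eventually (hlim.eventually_gt_atTop Δ)).exists
    have := Real.exp_pos t
    have h3 : Real.exp (-t) / (‖g 1 0‖ ^ 2 * Real.exp (-t) ^ 2) = Real.exp t / ‖g 1 0‖ ^ 2 := by
      rw [Real.exp_neg]
      field_simp
    rw [hheight, ← h0, zero_pow two_ne_zero, zero_add, h3] at h1
    linarith
  · have hlim : Tendsto (fun t => Real.exp (-t) / ‖g 1 0 * ξ + g 1 1‖ ^ 2) atTop (𝓝 0) := by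
      simpa using Real.tendsto_exp_neg_atTop_nhds_zero.div_const (‖g 1 0 * ξ + g 1 1‖ ^ 2)
    obtain ⟨t, ⟨h1, -⟩, h2⟩ := (hbounds.and_eventually (hlim.eventually_lt_const hδ)).exists
    rw [hheight] at h1
    have h3 : Real.exp (-t) / (‖g 1 0 * ξ + g 1 1‖ ^ 2 + ‖g 1 0‖ ^ 2 * Real.exp (-t) ^ 2) ≤
        Real.exp (-t) / ‖g 1 0 * ξ + g 1 1‖ ^ 2 := by
      apply div_le_div_of_nonneg_left (Real.exp_pos _).le (by positivity)
      nlinarith [sq_nonneg (‖g 1 0‖ * Real.exp (-t))]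
    linarith

/-- A locally finite set of reals, bounded below and unbounded above, is the range of an increasing
sequence. -/
theorem exists_strictMono_range_eq {S : Set ℝ} (hfin : ∀ a b, (S ∩ Icc a b).Finite) {m : ℝ}
    (hm : ∀ s ∈ S, m < s) (hunb : ∀ T, ∃ s, T < s ∧ s ∈ S) :
    ∃ t : ℕ → ℝ, StrictMono t ∧ range t = S := by
  have hnext : ∀ x, ∃ y ∈ S, x < y ∧ ∀ z ∈ S, x < z → y ≤ z := by
    intro x
    obtain ⟨y₀, hy₀, hy₀S⟩ := hunb x
    obtain ⟨y, ⟨hyS, hy⟩, hmin⟩ := Set.exists_min_image (S ∩ Ioc x y₀) id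
      ((hfin x y₀).subset (inter_subset_inter_right S Ioc_subset_Icc_self))
      ⟨y₀, hy₀S, hy₀, le_rfl⟩
    refine ⟨y, hyS, hy.1, fun z hz hxz => ?_⟩
    rcases le_total z y₀ with h | h
    · exact hmin z ⟨hz, hxz, h⟩
    · exact hy.2.trans h
  choose next hnS hlt hle using hnext
  set t : ℕ → ℝ := fun n => Nat.rec (next m) (fun _ x => next x) n with ht
  have hsucc : ∀ n, t (n + 1) = next (t n) := fun n => rfl
  have hmono : StrictMono t :=
    strictMono_nat_of_lt_succ fun n => (hlt (t n)).trans_eq (hsucc n).symm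
  have hmem : ∀ n, t n ∈ S := fun n => by
    cases n with
    | zero => exact hnS m
    | succ n => exact hnS (t n)
  refine ⟨t, hmono, Subset.antisymm (range_subset_iff.mpr hmem) fun z hz => ?_⟩
  by_contra hzr
  have hbelow : ∀ n, t n < z := by
    intro n
    have hne : t n ≠ z := fun h => hzr ⟨n, h⟩
    refine lt_of_le_of_ne ?_ hne
    induction n with
    | zero => exact hle m z hz (hm z hz)
    | succ n ih =>
      exact hle (t n) z hz (lt_of_le_of_ne (ih fun h => hzr ⟨n, h⟩) fun h => hzr ⟨n, h⟩)
  exact Set.infinite_range_of_injective hmono.injective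
    ((hfin m z).subset (range_subset_iff.mpr fun n => ⟨hmem n, (hm _ (hmem n)).le, (hbelow n).le⟩))

/-! ### Good approximants -/

/-- A minimizing ray leaves the cut locus at once. -/
theorem IsNearest.nearestEnds_rayTo (hd : DiscreteTopology Γ)
    (hcusp : IsParabolicPoint Γ OnePoint.infty) {g : SL(2, ℂ)} {x : H3} (hg : IsNearest Γ g x)
    {u : ℝ} (hu : 0 < u) :
    nearestEnds Γ (HypOrb.rayTo g x u) = {bact g⁻¹ OnePoint.infty} := by
  refine (nearestEnds_nonempty hd hcusp _).subset_singleton_iff.mp fun p hp => ?_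
  obtain ⟨k, hk, rfl⟩ := mem_nearestEnds_iff.mp hp
  have hmul : ∀ y, autFactor k y = autFactor (k * g⁻¹) (act g y) * autFactor g y := fun y => by
    rw [← autFactor_mul, inv_mul_cancel_right]
  have h1 := hk.le g hg.mem
  have h2 := hg.le k hk.mem
  rw [hmul, act_rayTo] at h1
  rw [hmul] at h2
  have h3 : autFactor (k * g⁻¹) (vray (act g x) u) ≤ 1 := by
    have := autFactor_pos g (HypOrb.rayTo g x u)
    by_contra! h
    nlinarith
  have h4 : 1 ≤ autFactor (k * g⁻¹) (act g x) := by
    have := autFactor_pos g x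
    by_contra! h
    nlinarith
  have hc : (k * g⁻¹) 1 0 = 0 := by
    by_contra hc
    have h5 := norm_pos_iff.mpr hc
    have h6 := height_pos (act g x)
    have h7 : 1 < Real.exp u := Real.one_lt_exp_iff.mpr hu
    have h8 := h3.trans h4
    simp only [autFactor, vproj_vray, height_vray] at h8
    have h9 : ‖(k * g⁻¹) 1 0‖ ^ 2 * height (act g x) ^ 2 <
        ‖(k * g⁻¹) 1 0‖ ^ 2 * (height (act g x) * Real.exp u) ^ 2 := by
      gcongr
      nlinarith
    linarith
  have h5 := (lower_left_eq_zero_iff _).mp hc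
  rw [bact_mul] at h5
  rw [mem_singleton_iff]
  conv_lhs => rw [← h5]
  rw [bact_inv_bact]

/-- The basins are the connected components of the complement of the cut locus, so that the ray on
the opposite side is the one that ends at the end of the basin being entered. -/
theorem IsCrossing.isOppositeEnd_iff (hd : DiscreteTopology Γ)
    (hcusp : IsParabolicPoint Γ OnePoint.infty) (htrans : StabilizerIsTranslations Γ) {ξ : ℂ}
    {s : ℝ} {p q r : OnePoint ℂ} (h : IsCrossing Γ ξ s p q) :
    IsOppositeEnd Γ ξ s r ↔ r = q := by
  have hleft : Tendsto (fun u => s - u) (𝓝[>] (0 : ℝ)) (𝓝[<] s) := by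
    rw [tendsto_nhdsWithin_iff]
    refine ⟨?_, ?_⟩
    · have : Tendsto (fun u => s - u) (𝓝 (0 : ℝ)) (𝓝 (s - 0)) := by
        exact (continuous_const.sub continuous_id).tendsto 0
      rw [sub_zero] at this
      exact this.mono_left nhdsWithin_le_nhds
    · filter_upwards [self_mem_nhdsWithin] with u hu
      exact sub_lt_self s hu
  have hbefore := hleft.eventually h.before
  constructor
  · rintro ⟨ρ, hρ, hnj⟩
    have hr : r ∈ nearestEnds Γ (line ξ s) := ⟨ρ, hρ⟩
    obtain ⟨g, hg, hgr⟩ := mem_nearestEnds_iff.mp hr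
    rw [h.nearestEnds_eq] at hr
    refine hr.resolve_left fun hrp => ?_
    obtain ⟨u, ⟨h1, h2⟩, h3⟩ := ((hnj.and hbefore).and self_mem_nhdsWithin).exists
    have h3 : 0 < u := h3
    apply h1
    have h4 : nearestEnds Γ (ρ u) = {p} := by
      rw [hgr] at hρ
      rw [hρ.eq_rayTo h3.le, hg.nearestEnds_rayTo hd hcusp h3, ← hgr, hrp]
    refine (joinedIn_of_nearestEnds_eq hd hcusp htrans (h2.trans h4.symm)).mono fun y hy => ?_
    exact notMem_cutLocus_of_eq_singleton (Eq.trans hy h2)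
  · rintro rfl
    have hq : r ∈ nearestEnds Γ (line ξ s) := by rw [h.nearestEnds_eq]; simp
    obtain ⟨g, hg, rfl⟩ := mem_nearestEnds_iff.mp hq
    refine ⟨_, hg.isMinimizingRay, ?_⟩
    filter_upwards [hbefore, self_mem_nhdsWithin] with u h1 h2 hj
    obtain ⟨c, hc⟩ := hj
    have h3 := nearestEnds_eq_of_isPreconnected hd hcusp (isPreconnected_range c.continuous) 1
      (by rintro _ ⟨v, rfl⟩; exact encard_nearestEnds_eq_one hd hcusp (hc v))
      ⟨0, c.source⟩ ⟨1, c.target⟩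
    rw [h1, hg.nearestEnds_rayTo hd hcusp h2, singleton_eq_singleton_iff] at h3
    exact h.ne h3

/-- The good approximants are the points at infinity of the successive basins that the line
visits, and it starts in the basin of `∞ = γ (-1) ∞`. -/
theorem IsGoodApproximation.isCrossing (hd : DiscreteTopology Γ)
    (hcusp : IsParabolicPoint Γ OnePoint.infty) (htrans : StabilizerIsTranslations Γ) {ξ : ℂ}
    (hξ : IsTotallyIrrational Γ ξ) {t : ℕ → ℝ} {z : ℕ → ℂ} {γ : ℤ → SL(2, ℂ)}
    (h : IsGoodApproximation Γ ξ t z γ) (n : ℕ) :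
    IsCrossing Γ ξ (t n) (bact (γ (n - 1)) OnePoint.infty) (bact (γ n) OnePoint.infty) := by
  have hcut : ∀ m, line ξ (t m) ∈ cutLocus Γ := fun m =>
    (h.range_eq ▸ mem_range_self m : t m ∈ {s | line ξ s ∈ cutLocus Γ})
  have hex : ∀ m, ∃ p, IsCrossing Γ ξ (t m) p (z m) := fun m => by
    obtain ⟨p, q, hpq⟩ := hξ.exists_isCrossing hd hcusp htrans (hcut m)
    rw [(hpq.isOppositeEnd_iff hd hcusp htrans).mp (h.oppositeEnd m)]
    exact ⟨p, hpq⟩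
  have hmem : ∀ u, line ξ u ∈ cutLocus Γ → ∃ m, t m = u := fun u hu => by
    have : u ∈ range t := h.range_eq ▸ hu
    exact this
  obtain ⟨p, hp⟩ := hex n
  rw [h.apply_infty n]
  suffices bact (γ (n - 1)) OnePoint.infty = p by rwa [this]
  cases n with
  | zero =>
    have hno : ∀ u ∈ Iio (t 0), line ξ u ∉ cutLocus Γ := by
      intro u hu hc
      obtain ⟨m, rfl⟩ := hmem u hc
      exact absurd (h.strictMono.monotone (Nat.zero_le m)) (not_le.mpr hu)
    obtain ⟨u, hu, hu0⟩ := ((eventually_nearestEnds_line_atBot hd hcusp ξ).and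
      (eventually_lt_atBot (t 0))).exists
    obtain ⟨v, hv, hv0⟩ := (hp.before.and self_mem_nhdsWithin).exists
    have := nearestEnds_line_eq hd hcusp isPreconnected_Iio hno hu0 hv0
    rw [hu, hv, singleton_eq_singleton_iff] at this
    rw [Nat.cast_zero, zero_sub, h.neg_one, bact_one, this]
  | succ n =>
    obtain ⟨p', hp'⟩ := hex n
    have hlt : t n < t (n + 1) := h.strictMono (Nat.lt_succ_self n)
    have hno : ∀ u ∈ Ioo (t n) (t (n + 1)), line ξ u ∉ cutLocus Γ := by
      rintro u ⟨hu1, hu2⟩ hc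
      obtain ⟨m, rfl⟩ := hmem u hc
      have h1 := h.strictMono.lt_iff_lt.mp hu1
      have h2 := h.strictMono.lt_iff_lt.mp hu2
      omega
    obtain ⟨u, hu, hu0⟩ := (hp'.after.and (Ioo_mem_nhdsGT hlt)).exists
    obtain ⟨v, hv, hv0⟩ := (hp.before.and (Ioo_mem_nhdsLT hlt)).exists
    have := nearestEnds_line_eq hd hcusp isPreconnected_Ioo hno hu0 hv0
    rw [hu, hv, singleton_eq_singleton_iff] at this
    rw [Nat.cast_succ, add_sub_cancel_right, h.apply_infty n, this]

theorem IsTotallyIrrational.exists_isGoodApproximation (hd : DiscreteTopology Γ)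
    (hcusp : IsParabolicPoint Γ OnePoint.infty) (htrans : StabilizerIsTranslations Γ) {ξ : ℂ}
    (hξ : IsTotallyIrrational Γ ξ) : ∃ t z γ, IsGoodApproximation Γ ξ t z γ := by
  obtain ⟨m, hm⟩ := eventually_atBot.mp (eventually_nearestEnds_line_atBot hd hcusp ξ)
  obtain ⟨t, ht, hrange⟩ := exists_strictMono_range_eq
    (hξ.finite_cut_inter_Icc hd hcusp htrans)
    (fun s hs => not_le.mp fun hle => notMem_cutLocus_of_eq_singleton (hm s hle) hs)
    (hξ.1.exists_mem_cutLocus hd hcusp htrans)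
  have hex : ∀ n, ∃ (w : ℂ) (g : SL(2, ℂ)), g ∈ Γ ∧ bact g OnePoint.infty = w ∧
      IsOppositeEnd Γ ξ (t n) w := fun n => by
    have hcut : line ξ (t n) ∈ cutLocus Γ :=
      (hrange ▸ mem_range_self n : t n ∈ {s | line ξ s ∈ cutLocus Γ})
    obtain ⟨p, q, hpq⟩ := hξ.exists_isCrossing hd hcusp htrans hcut
    obtain ⟨w, rfl⟩ := OnePoint.ne_infty_iff_exists.mp hpq.ne_infty
    have hw := (hpq.isOppositeEnd_iff hd hcusp htrans).mpr rfl
    obtain ⟨g, hg, hgw⟩ := mem_nearestEnds_iff.mp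
      (show (w : OnePoint ℂ) ∈ nearestEnds Γ (line ξ (t n)) by rw [hpq.nearestEnds_eq]; simp)
    exact ⟨w, g⁻¹, Γ.inv_mem hg.mem, hgw.symm, hw⟩
  choose z g hg hgz hz using hex
  exact ⟨t, z, fun i => if 0 ≤ i then g i.toNat else 1, ht, hrange, hz,
    fun n => by simpa using hg n, fun n => by simpa using hgz n, by simp⟩

/-! ### The continued sequence -/

/-- The terms of the continued sequence are the displacements, seen from the end `γ n ∞` of the
basin crossed by the line, between the previous end and the next one. -/
theorem ContinuedPath.displacement (hd : DiscreteTopology Γ)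
    (hcusp : IsParabolicPoint Γ OnePoint.infty) (htrans : StabilizerIsTranslations Γ) {ξ : ℂ}
    {s s' : ℝ} {p : OnePoint ℂ} {k₀ k k' : SL(2, ℂ)} (hk₀ : k₀ ∈ Γ) (hk : k ∈ Γ) (hk' : k' ∈ Γ)
    (hp : bact k OnePoint.infty = p)
    (h : IsCrossing Γ ξ s (bact k₀ OnePoint.infty) p)
    (h' : IsCrossing Γ ξ s' p (bact k' OnePoint.infty))
    (c : ContinuedPath Γ ξ s s' p) {w : ℂ}
    (hw : HasDisplacement Γ
      (Path.Homotopic.Quotient.mk (c.total.map (retraction Γ k).continuous)) w) :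
    ∃ u v : ℂ, bact k⁻¹ (bact k' OnePoint.infty) = u ∧ bact k⁻¹ (bact k₀ OnePoint.infty) = v ∧
      w = u - v := by
  subst hp
  rw [hasDisplacement_retraction_iff hd] at hw
  have hray : ∀ {x l : H3},
      (∃ ρ, IsMinimizingRay Γ x (bact k OnePoint.infty) ρ ∧ l ∈ ρ '' Ici 0) →
      vproj (act k⁻¹ l) = vproj (act k⁻¹ x) := by
    rintro x l ⟨ρ, hρ, s, hs, rfl⟩
    rw [← inv_inv k] at hρ
    rw [hρ.eq_rayTo hs, act_rayTo, vproj_vray]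
  obtain ⟨ρ, hρ, hmem⟩ := c.rayIn_mem
  have h1 := hray ⟨ρ, hρ, by simpa using hmem 0⟩
  obtain ⟨ρ', hρ', hmem'⟩ := c.rayOut_mem
  have h2 := hray ⟨ρ', hρ', by simpa using hmem' 1⟩
  refine ⟨_, _, ?_, ?_, by rw [hw, h1, h2]⟩
  · have := c.summit'.bact_eq_vproj hd hcusp htrans (g := k⁻¹) (g' := k'⁻¹) (Γ.inv_mem hk)
      (Γ.inv_mem hk') (by simpa using h'.ne) (by simpa using h'.nearestEnds_eq)
    rwa [inv_inv] at this
  · have := c.summit.bact_eq_vproj hd hcusp htrans (g := k⁻¹) (g' := k₀⁻¹) (Γ.inv_mem hk)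
      (Γ.inv_mem hk₀) (by simpa using h.ne.symm)
      (by simpa using h.nearestEnds_eq.trans (pair_comm _ _))
    rwa [inv_inv] at this

/-- The part of a vertical line between two parameters, as a path. -/
noncomputable def linePath (ξ : ℂ) (s s' : ℝ) : Path (line ξ s) (line ξ s') where
  toFun u := line ξ ((1 - u) * s + u * s')
  continuous_toFun := (continuous_line ξ).comp (by fun_prop)
  source' := by simp
  target' := by simp

/-- The path is made of geodesic segments, with constant paths on the two rays. -/
theorem exists_continuedPath (hd : DiscreteTopology Γ)
    (hcusp : IsParabolicPoint Γ OnePoint.infty) (htrans : StabilizerIsTranslations Γ)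
    (hsummits : CellsHaveSummits Γ) {ξ : ℂ} {s s' : ℝ} (hss' : s ≤ s') {p : OnePoint ℂ}
    (hs : line ξ s ∈ regCutLocus Γ) (hs' : line ξ s' ∈ regCutLocus Γ)
    (hp : p ∈ nearestEnds Γ (line ξ s)) (hp' : p ∈ nearestEnds Γ (line ξ s')) :
    Nonempty (ContinuedPath Γ ξ s s' p) := by
  obtain ⟨y, hy⟩ := hsummits _ hs
  obtain ⟨y', hy'⟩ := hsummits _ hs'
  have hcell := cell_eq hd hcusp htrans hs
  have hcell' := cell_eq hd hcusp htrans hs'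
  have hE : nearestEnds Γ y = nearestEnds Γ (line ξ s) := by
    have := hy.1
    rwa [hcell] at this
  have hE' : nearestEnds Γ y' = nearestEnds Γ (line ξ s') := by
    have := hy'.1
    rwa [hcell'] at this
  obtain ⟨ρ, hρ⟩ := show p ∈ nearestEnds Γ y by rwa [hE]
  obtain ⟨ρ', hρ'⟩ := show p ∈ nearestEnds Γ y' by rwa [hE']
  refine ⟨{
    l := y
    y := y
    y' := y'
    l' := y'
    summit := hy
    summit' := hy'
    rayIn := Path.refl y
    rayIn_mem := ⟨ρ, hρ, fun _ => ⟨0, mem_Ici.mpr le_rfl, hρ.start⟩⟩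
    cellIn := segmentPath y (line ξ s)
    cellIn_mem := fun u => by
      rw [hcell]
      exact (nearestEnds_segment hd hcusp htrans hE u).trans hE
    along := linePath ξ s s'
    along_mem := fun u => ⟨_, ?_, rfl⟩
    cellOut := segmentPath (line ξ s') y'
    cellOut_mem := fun u => by
      rw [hcell']
      exact nearestEnds_segment hd hcusp htrans hE'.symm u
    rayOut := Path.refl y'
    rayOut_mem := ⟨ρ', hρ', fun _ => ⟨0, mem_Ici.mpr le_rfl, hρ'.start⟩⟩ }⟩
  have h0 := u.2.1
  have h1 := u.2.2
  constructor <;> nlinarith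

theorem IsGoodApproximation.exists_isContinuedSequence (hd : DiscreteTopology Γ)
    (hcusp : IsParabolicPoint Γ OnePoint.infty) (htrans : StabilizerIsTranslations Γ)
    (hsummits : CellsHaveSummits Γ) {ξ : ℂ} (hξ : IsTotallyIrrational Γ ξ) {t : ℕ → ℝ}
    {z : ℕ → ℂ} {γ : ℤ → SL(2, ℂ)} (h : IsGoodApproximation Γ ξ t z γ) :
    ∃ a, IsContinuedSequence Γ ξ t z γ a := by
  have hcross := h.isCrossing hd hcusp htrans hξ
  have hreg : ∀ n, line ξ (t n) ∈ regCutLocus Γ := fun n => by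
    rw [regCutLocus, mem_ofPred_eq, (hcross n).nearestEnds_eq, encard_pair (hcross n).ne]
  have hex : ∀ n : ℕ, Nonempty (ContinuedPath Γ ξ (t n) (t (n + 1)) (z n)) := fun n => by
    refine exists_continuedPath hd hcusp htrans hsummits (h.strictMono (Nat.lt_succ_self n)).le
      (hreg n) (hreg (n + 1)) ?_ ?_
    · rw [(hcross n).nearestEnds_eq, h.apply_infty n]
      simp
    · rw [(hcross (n + 1)).nearestEnds_eq, Nat.cast_succ, add_sub_cancel_right, h.apply_infty n]
      simp
  refine ⟨fun n => Nat.casesOn n 0 fun n => vproj (act (γ n)⁻¹ (hex n).some.l') -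
    vproj (act (γ n)⁻¹ (hex n).some.l), rfl, fun n => ⟨(hex n).some, ?_⟩⟩
  rw [hasDisplacement_retraction_iff hd]

theorem lower_left_ne_zero {g : SL(2, ℂ)} {z : ℂ} (h : bact g OnePoint.infty = z) :
    g 1 0 ≠ 0 ∧ z = g 0 0 / g 1 0 := by
  rw [bact_infty] at h
  split_ifs at h with hc
  · exact absurd h (OnePoint.infty_ne_coe z)
  · exact ⟨hc, (OnePoint.coe_eq_coe.mp h).symm⟩

/-- The identity `g⁻¹ w = -d / c + 1 / (c ^ 2 * (g ∞ - w))`. -/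
theorem sq_mul_of_bact_inv_eq {g : SL(2, ℂ)} {z w u : ℂ} (hz : bact g OnePoint.infty = z)
    (hw : z ≠ w) (hu : bact g⁻¹ w = u) :
    (g 1 0) ^ 2 * u = 1 / (z - w) - g 1 0 * g 1 1 := by
  obtain ⟨hc, rfl⟩ := lower_left_ne_zero hz
  obtain ⟨e00, e01, e10, e11⟩ := inv_entries g
  have hdet := det_eq g
  have hzw := sub_ne_zero.mpr hw
  have hne : g 0 0 - g 1 0 * w ≠ 0 := by
    intro h0
    apply hzw
    field_simp
    linear_combination h0
  rw [bact_coe, e00, e01, e10, e11, if_neg (by rwa [neg_mul, neg_add_eq_sub]),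
    OnePoint.coe_eq_coe] at hu
  have h1 : g 0 0 / g 1 0 - w = (g 0 0 - g 1 0 * w) / g 1 0 := by
    field_simp
  rw [← hu, h1, neg_mul, neg_add_eq_sub, one_div_div]
  field_simp
  linear_combination hdet

theorem sq_mul_of_bact_inv_infty_eq {g : SL(2, ℂ)} {z u : ℂ} (hz : bact g OnePoint.infty = z)
    (hu : bact g⁻¹ OnePoint.infty = u) : (g 1 0) ^ 2 * u = -(g 1 0 * g 1 1) := by
  obtain ⟨hc, -⟩ := lower_left_ne_zero hz
  rw [bact_inv_infty g hc, OnePoint.coe_eq_coe] at hu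
  rw [← hu]
  field_simp

/-- The recurrence satisfied by the good approximants determines them: the alternating sums are, up
to sign, the inverses of the differences of consecutive good approximants. -/
theorem alternating_sum_eq {K : Type*} [Field K] {z b : ℕ → K} (h0 : b 0 = 0)
    (h1 : b 1 = 1 / (z 0 - z 1))
    (h2 : ∀ n, b (n + 2) = 1 / (z (n + 1) - z (n + 2)) - 1 / (z (n + 1) - z n)) (k : ℕ) :
    ∑ i ∈ Finset.range (k + 2), (-1) ^ i * b i = (-1) ^ k / (z (k + 1) - z k) := by
  have hneg : ∀ x y : K, 1 / (x - y) = -(1 / (y - x)) := fun x y => by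
    rw [← neg_sub y x, one_div_neg_eq_neg_one_div]
  induction k with
  | zero =>
    rw [Finset.sum_range_succ, Finset.sum_range_one, h0, h1, hneg]
    ring
  | succ k ih =>
    rw [Finset.sum_range_succ, ih, h2, hneg (z (k + 1)) (z (k + 2))]
    ring

theorem eq_sum_of_recurrence {K : Type*} [Field K] {z b : ℕ → K} (h0 : b 0 = 0)
    (h1 : b 1 = 1 / (z 0 - z 1))
    (h2 : ∀ n, b (n + 2) = 1 / (z (n + 1) - z (n + 2)) - 1 / (z (n + 1) - z n))
    (hne : ∀ n, z n ≠ z (n + 1)) (n : ℕ) :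
    (∀ k ∈ Finset.Icc 1 n, ∑ i ∈ Finset.range (k + 1), (-1) ^ i * b i ≠ 0) ∧
    z n = z 0 + ∑ k ∈ Finset.Icc 1 n,
      (-1) ^ (k + 1) / ∑ i ∈ Finset.range (k + 1), (-1) ^ i * b i := by
  have hS := alternating_sum_eq h0 h1 h2
  have hsub : ∀ k, z (k + 1) - z k ≠ 0 := fun k => sub_ne_zero.mpr (hne k).symm
  constructor
  · intro k hk
    obtain ⟨k, rfl⟩ := Nat.exists_eq_add_of_le' (Finset.mem_Icc.mp hk).1
    rw [hS]
    exact div_ne_zero (pow_ne_zero _ (neg_ne_zero.mpr one_ne_zero)) (hsub k)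
  · induction n with
    | zero => simp
    | succ n ih =>
      rw [Finset.sum_Icc_succ_top (Nat.le_add_left 1 n), ← add_assoc, ← ih, hS, div_div_eq_mul_div,
        pow_succ, pow_succ]
      have : ((-1 : K) ^ n) ≠ 0 := pow_ne_zero _ (neg_ne_zero.mpr one_ne_zero)
      field_simp
      ring

end HypOrb

open HypOrb in
theorem mainTheorem7 (Γ : Subgroup SL(2, ℂ)) (hdiscrete : DiscreteTopology Γ)
    (hfinite : HypOrb.IsGeometricallyFinite Γ) (hnonelem : HypOrb.IsNonElementary Γ)
    (hcusp : HypOrb.IsParabolicPoint Γ OnePoint.infty)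
    (htrans : HypOrb.StabilizerIsTranslations Γ)
    (hsummits : HypOrb.CellsHaveSummits Γ)
    (ξ : ℂ) (hξ : HypOrb.IsTotallyIrrational Γ ξ) :
    (∃ (t : ℕ → ℝ) (z : ℕ → ℂ) (γ : ℤ → SL(2, ℂ)) (a : ℕ → ℂ),
      HypOrb.IsGoodApproximation Γ ξ t z γ ∧ HypOrb.IsContinuedSequence Γ ξ t z γ a) ∧
    ∀ (t : ℕ → ℝ) (z : ℕ → ℂ) (γ : ℤ → SL(2, ℂ)) (a : ℕ → ℂ) (q : ℤ → ℂ),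
      HypOrb.IsGoodApproximation Γ ξ t z γ → HypOrb.IsContinuedSequence Γ ξ t z γ a →
      (∀ i, q i = (γ i) 1 0) →
      ∀ n : ℕ,
        (∀ k ∈ Finset.Icc 1 n,
          ∑ i ∈ Finset.range (k + 1), (-1) ^ i * q ((i : ℤ) - 1) ^ 2 * a i ≠ 0) ∧
        z n = z 0 + ∑ k ∈ Finset.Icc 1 n,
          (-1) ^ (k + 1) /
            ∑ i ∈ Finset.range (k + 1), (-1) ^ i * q ((i : ℤ) - 1) ^ 2 * a i := by
  constructor
  · obtain ⟨t, z, γ, h⟩ := hξ.exists_isGoodApproximation hdiscrete hcusp htrans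
    obtain ⟨a, ha⟩ := h.exists_isContinuedSequence hdiscrete hcusp htrans hsummits hξ
    exact ⟨t, z, γ, a, h, ha⟩
  intro t z γ a q h ha hq n
  have hcross := h.isCrossing hdiscrete hcusp htrans hξ
  have hmem : ∀ m : ℕ, γ ((m : ℤ) - 1) ∈ Γ := fun m => by
    cases m with
    | zero => rw [Nat.cast_zero, zero_sub, h.neg_one]; exact Γ.one_mem
    | succ m => rw [Nat.cast_succ, add_sub_cancel_right]; exact h.mem m
  have hprev : ∀ m : ℕ, bact (γ (((m + 1 : ℕ) : ℤ) - 1)) OnePoint.infty = z m := fun m => by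
    rw [Nat.cast_succ, add_sub_cancel_right, h.apply_infty]
  have hne : ∀ m, z m ≠ z (m + 1) := fun m he => by
    have := (hcross (m + 1)).ne
    rw [hprev, h.apply_infty, he] at this
    exact this rfl
  have hdisp : ∀ m : ℕ, ∃ u v : ℂ, bact (γ m)⁻¹ (z (m + 1)) = u ∧
      bact (γ m)⁻¹ (bact (γ ((m : ℤ) - 1)) OnePoint.infty) = v ∧ a (m + 1) = u - v := fun m => by
    obtain ⟨c, hc⟩ := ha.2 m
    have h1 := hcross m
    have h2 := hcross (m + 1)
    rw [h.apply_infty] at h1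
    rw [hprev] at h2
    have := c.displacement hdiscrete hcusp htrans (hmem m) (h.mem m) (h.mem (m + 1))
      (h.apply_infty m) h1 h2 hc
    rwa [h.apply_infty] at this
  have hqm : ∀ m : ℕ, q (((m + 1 : ℕ) : ℤ) - 1) = (γ m) 1 0 := fun m => by
    rw [hq, Nat.cast_succ, add_sub_cancel_right]
  have hrec := eq_sum_of_recurrence (z := z) (b := fun i => q ((i : ℤ) - 1) ^ 2 * a i)
    (by simp only [ha.1, mul_zero]) ?_ ?_ hne n
  · simpa only [mul_assoc] using hrec
  · obtain ⟨u, v, hu, hv, huv⟩ := hdisp 0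
    rw [Nat.cast_zero, zero_sub, h.neg_one, bact_one] at hv
    have h1 := sq_mul_of_bact_inv_eq (h.apply_infty 0) (hne 0) hu
    have h2 := sq_mul_of_bact_inv_infty_eq (h.apply_infty 0) hv
    simp only [hqm 0, huv]
    linear_combination h1 - h2
  · intro m
    obtain ⟨u, v, hu, hv, huv⟩ := hdisp (m + 1)
    rw [hprev] at hv
    have h1 := sq_mul_of_bact_inv_eq (h.apply_infty (m + 1)) (hne (m + 1)) hu
    have h2 := sq_mul_of_bact_inv_eq (h.apply_infty (m + 1)) (hne m).symm hv
    simp only [hqm (m + 1), huv]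
    linear_combination h1 - h2
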